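/- Let $N\ge 3$ and let $\Omega\subset\mathbb R^N$ be a nonempty bounded open set (in particular, any smooth bounded domain). Put $2^*=\frac{2N}{N-2}$ and let $H^1_0(\Omega)$, the closure of $C_c^\infty(\Omega)$ in the $H^1$ norm, be endowed with the norm $\|v\|=\big(\int_\Omega|\nabla v|^2\big)^{1/2}$. Let $$S=\inf_{u\in H^1_0(\Omega)\setminus\{0\}}\frac{\int_\Omega|\nabla u|^2}{\big(\int_\Omega|u|^{2^*}\big)^{2/2^*}}$$ be the best Sobolev constant of the embedding $H^1_0(\Omega)\subset L^{2^*}(\Omega)$. Let $f:\mathbb R\to\mathbb R$ be the unique odd function with $f'(t)=\big(1+2f(t)^2\big)^{-1/2}$ for $t\ge 0$, and let $I_*:H^1_0(\Omega)\to\mathbb R$ be the functional $$I_*(v)=\frac12\int_\Omega|\nabla v|^2-\frac1{2\cdot 2^*}\int_\Omega|f(v)|^{2\cdot 2^*}.$$ Then $I_*$ satisfies the Palais–Smale condition at every level $d\in\mathbb R$ with $$d<\frac1N\Big(\frac S2\Big)^{N/2};$$ that is, every sequence $(v_n)$ in $H^1_0(\Omega)$ such that $I_*(v_n)\to d$ and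 $I_*'(v_n)\to 0$ in the dual space of $H^1_0(\Omega)$ has a subsequence that converges in $H^1_0(\Omega)$. -/

import Mathlib

open MeasureTheory Filter Topology
open scoped ContDiff ENNReal NNReal

noncomputable section

namespace QuasilinearPS

/-! ### The change of variable `f` -/

/-- The primitive `s ↦ ∫₀ˢ √(1 + 2 τ²) dτ`, whose inverse function is the change of variable. -/
def primitiveSqrt (s : ℝ) : ℝ := ∫ τ in (0 : ℝ)..s, √(1 + 2 * τ ^ 2)

theorem continuous_integrand : Continuous fun τ : ℝ => √(1 + 2 * τ ^ 2) := by fun_prop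

theorem hasDerivAt_primitiveSqrt (s : ℝ) :
    HasDerivAt primitiveSqrt (√(1 + 2 * s ^ 2)) s :=
  intervalIntegral.integral_hasDerivAt_right (continuous_integrand.intervalIntegrable _ _)
    (continuous_integrand.stronglyMeasurableAtFilter _ _) continuous_integrand.continuousAt

theorem integrand_pos (s : ℝ) : 0 < √(1 + 2 * s ^ 2) := Real.sqrt_pos.2 (by positivity)

theorem strictMono_primitiveSqrt : StrictMono primitiveSqrt :=
  strictMono_of_hasDerivAt_pos hasDerivAt_primitiveSqrt integrand_pos

theorem primitiveSqrt_neg (s : ℝ) : primitiveSqrt (-s) = -primitiveSqrt s := by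
  have h := intervalIntegral.integral_comp_neg (a := 0) (b := s)
    (fun τ : ℝ => √(1 + 2 * τ ^ 2))
  simp only [neg_sq, neg_zero] at h
  rw [primitiveSqrt, primitiveSqrt, h, intervalIntegral.integral_symm]

theorem le_primitiveSqrt {s : ℝ} (hs : 0 ≤ s) : s ≤ primitiveSqrt s := by
  have h : (∫ _ in (0 : ℝ)..s, (1 : ℝ)) ≤ primitiveSqrt s := by
    refine intervalIntegral.integral_mono_on hs (by simp)
      (continuous_integrand.intervalIntegrable _ _) fun x _ => ?_
    rw [Real.one_le_sqrt]
    nlinarith [sq_nonneg x]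
  simpa using h

theorem surjective_primitiveSqrt : Function.Surjective primitiveSqrt := by
  have htop : Tendsto primitiveSqrt atTop atTop :=
    tendsto_atTop_mono' _ ((eventually_ge_atTop 0).mono fun s hs => le_primitiveSqrt hs) tendsto_id
  refine Continuous.surjective
    (continuous_iff_continuousAt.2 fun s => (hasDerivAt_primitiveSqrt s).continuousAt) htop ?_
  have h := tendsto_neg_atTop_atBot.comp (htop.comp tendsto_neg_atBot_atTop)
  refine h.congr fun s => ?_
  simp [primitiveSqrt_neg]

/-- The change of variable `f : ℝ → ℝ`, that is, the odd solution of
`f' = (1 + 2 f²)^(-1/2)` on `[0, ∞)`; it is built as the inverse function of `primitiveSqrt`.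
The defining properties are `changeVar_neg` and `hasDerivAt_changeVar`. -/
def changeVar : ℝ → ℝ :=
  (strictMono_primitiveSqrt.orderIsoOfSurjective primitiveSqrt surjective_primitiveSqrt).symm

theorem primitiveSqrt_changeVar (t : ℝ) : primitiveSqrt (changeVar t) = t :=
  (strictMono_primitiveSqrt.orderIsoOfSurjective primitiveSqrt
    surjective_primitiveSqrt).apply_symm_apply t

theorem continuous_changeVar : Continuous changeVar :=
  (strictMono_primitiveSqrt.orderIsoOfSurjective primitiveSqrt
    surjective_primitiveSqrt).symm.continuous

theorem changeVar_neg (t : ℝ) : changeVar (-t) = -changeVar t := by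
  apply strictMono_primitiveSqrt.injective
  rw [primitiveSqrt_neg, primitiveSqrt_changeVar, primitiveSqrt_changeVar]

theorem hasDerivAt_changeVar (t : ℝ) :
    HasDerivAt changeVar (1 / √(1 + 2 * changeVar t ^ 2)) t := by
  rw [one_div]
  exact HasDerivAt.of_local_left_inverse continuous_changeVar.continuousAt
    (hasDerivAt_primitiveSqrt _) (integrand_pos _).ne'
    (Eventually.of_forall primitiveSqrt_changeVar)

/-- The two defining properties determine the change of variable. -/
theorem eq_changeVar {g : ℝ → ℝ} (hodd : ∀ t, g (-t) = -g t)
    (hder : ∀ t, 0 ≤ t → HasDerivWithinAt g (1 / √(1 + 2 * g t ^ 2)) (Set.Ici 0) t) :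
    g = changeVar := by
  have hg0 : g 0 = 0 := by have := hodd 0; simp at this; linarith
  have hP0 : primitiveSqrt 0 = 0 := by simp [primitiveSqrt]
  have key : ∀ t, 0 ≤ t → primitiveSqrt (g t) = t := by
    intro t ht
    have hd : ∀ x ∈ Set.Ici (0 : ℝ),
        HasDerivWithinAt (fun x => primitiveSqrt (g x) - x) 0 (Set.Ici 0) x := by
      intro x hx
      have h := ((hasDerivAt_primitiveSqrt (g x)).comp_hasDerivWithinAt x (hder x hx)).sub
        (hasDerivWithinAt_id x _)
      have e : √(1 + 2 * g x ^ 2) * (1 / √(1 + 2 * g x ^ 2)) - 1 = 0 := by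
        rw [mul_one_div_cancel (integrand_pos _).ne', sub_self]
      rw [e] at h
      exact h
    have hc := (convex_Ici (0 : ℝ)).norm_image_sub_le_of_norm_hasDerivWithin_le
      (C := 0) hd (by simp) (Set.self_mem_Ici) (show t ∈ Set.Ici (0 : ℝ) from ht)
    simp [hg0, hP0] at hc
    linarith
  funext t
  apply strictMono_primitiveSqrt.injective
  rw [primitiveSqrt_changeVar]
  rcases le_total 0 t with ht | ht
  · exact key t ht
  · have h := key (-t) (by linarith)
    rw [hodd, primitiveSqrt_neg] at h
    linarith

/-! ### The Sobolev space `H¹₀(Ω)` -/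

/-- Euclidean space `ℝ^N`. -/
abbrev E (N : ℕ) : Type := EuclideanSpace ℝ (Fin N)

variable {N : ℕ}

/-- `φ` is a test function: `φ ∈ C_c^∞(Ω)`. -/
def IsTestFunction (Ω : Set (E N)) (φ : E N → ℝ) : Prop :=
  ContDiff ℝ ∞ φ ∧ HasCompactSupport φ ∧ tsupport φ ⊆ Ω

theorem gradient_add_apply {φ ψ : E N → ℝ} (hφ : ContDiff ℝ ∞ φ) (hψ : ContDiff ℝ ∞ ψ) (x : E N) :
    gradient (φ + ψ) x = gradient φ x + gradient ψ x := by
  have h1 := (hφ.differentiable (by simp)) x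
  have h2 := (hψ.differentiable (by simp)) x
  simp only [gradient]
  rw [fderiv_add h1 h2, map_add]

theorem gradient_smul_apply {φ : E N → ℝ} (hφ : ContDiff ℝ ∞ φ) (c : ℝ) (x : E N) :
    gradient (c • φ) x = c • gradient φ x := by
  have h1 := (hφ.differentiable (by simp)) x
  simp only [gradient]
  rw [fderiv_const_smul h1]
  simp

/-- The pairs `(φ, ∇φ)` in `L²(Ω) × L²(Ω; ℝ^N)` with `φ ∈ C_c^∞(Ω)`. -/
def testPairs (Ω : Set (E N)) :
    Submodule ℝ (Lp ℝ 2 (volume.restrict Ω) × Lp (E N) 2 (volume.restrict Ω)) where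
  carrier := {p | ∃ φ, IsTestFunction Ω φ ∧
    p.1 =ᵐ[volume.restrict Ω] φ ∧ p.2 =ᵐ[volume.restrict Ω] gradient φ}
  zero_mem' := by
    refine ⟨0, ⟨contDiff_const, HasCompactSupport.zero, by simp [tsupport]⟩, ?_, ?_⟩
    · exact Lp.coeFn_zero _ _ _
    · have : gradient (0 : E N → ℝ) = 0 := by
        funext x
        exact gradient_fun_const x 0
      rw [this]
      exact Lp.coeFn_zero _ _ _
  add_mem' := by
    rintro p q ⟨φ, hφ, h1, h2⟩ ⟨ψ, hψ, h3, h4⟩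
    refine ⟨φ + ψ, ⟨hφ.1.add hψ.1, hφ.2.1.add hψ.2.1,
      (tsupport_add φ ψ).trans (Set.union_subset hφ.2.2 hψ.2.2)⟩, ?_, ?_⟩
    · filter_upwards [h1, h3, Lp.coeFn_add p.1 q.1] with x a b c
      simp only [Prod.fst_add, c, Pi.add_apply, a, b]
    · filter_upwards [h2, h4, Lp.coeFn_add p.2 q.2] with x a b c
      simp only [Prod.snd_add, c, Pi.add_apply, a, b]
      exact (gradient_add_apply hφ.1 hψ.1 x).symm
  smul_mem' := by
    rintro c p ⟨φ, hφ, h1, h2⟩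
    refine ⟨c • φ, ⟨contDiff_const.smul hφ.1, hφ.2.1.smul_left (f := fun _ => c),
      (tsupport_smul_subset_right (fun _ => c) φ).trans hφ.2.2⟩, ?_, ?_⟩
    · filter_upwards [h1, Lp.coeFn_smul c p.1] with x a b
      simp only [Prod.smul_fst, b, Pi.smul_apply, a]
    · filter_upwards [h2, Lp.coeFn_smul c p.2] with x a b
      simp only [Prod.smul_snd, b, Pi.smul_apply, a]
      exact (gradient_smul_apply hφ.1 c x).symm

/-- The Sobolev space `H¹₀(Ω)`: the closure of `C_c^∞(Ω)` for the `H¹` norm. An element is stored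
as the pair `(u, ∇u)` in `L²(Ω) × L²(Ω; ℝ^N)`. -/
def H10 (Ω : Set (E N)) : Type := ↥((testPairs Ω).topologicalClosure)

variable {Ω : Set (E N)}

instance : AddCommGroup (H10 Ω) :=
  inferInstanceAs (AddCommGroup ↥((testPairs Ω).topologicalClosure))

instance : Module ℝ (H10 Ω) :=
  inferInstanceAs (Module ℝ ↥((testPairs Ω).topologicalClosure))

/-- The inclusion `H¹₀(Ω) → L²(Ω)`. -/
def H10.toL2 : H10 Ω →ₗ[ℝ] Lp ℝ 2 (volume.restrict Ω) :=
  (LinearMap.fst ℝ _ _).comp (testPairs Ω).topologicalClosure.subtype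

/-- The weak gradient of an element of `H¹₀(Ω)`, in `L²(Ω; ℝ^N)`. -/
def H10.grad : H10 Ω →ₗ[ℝ] Lp (E N) 2 (volume.restrict Ω) :=
  (LinearMap.snd ℝ _ _).comp (testPairs Ω).topologicalClosure.subtype

/-- Sobolev's inequality on a test pair, used only to see that the gradient is injective. -/
theorem exists_sobolev_testPairs (hN : 3 ≤ N) : ∃ (q C : ℝ≥0), q ≠ 0 ∧
    ∀ p ∈ testPairs Ω, eLpNorm p.1 q (volume.restrict Ω) ≤ C * ‖p.2‖ₑ := by
  have hN' : (3 : ℝ) ≤ N := by exact_mod_cast hN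
  have hpos : (0 : ℝ) < 2⁻¹ - (N : ℝ)⁻¹ := by
    have : (N : ℝ)⁻¹ ≤ 3⁻¹ := by gcongr
    norm_num at this ⊢
    linarith
  let q : ℝ≥0 := ⟨(2⁻¹ - (N : ℝ)⁻¹)⁻¹, by positivity⟩
  have hq : (q : ℝ) = (2⁻¹ - (N : ℝ)⁻¹)⁻¹ := rfl
  refine ⟨q, eLpNormLESNormFDerivOfEqInnerConst (volume : Measure (E N)) 2, ?_, ?_⟩
  · intro h
    rw [h, NNReal.coe_zero] at hq
    exact (inv_pos.2 hpos).ne hq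
  · rintro p ⟨φ, ⟨hφ, hc, hs⟩, h1, h2⟩
    have hsob := eLpNorm_le_eLpNorm_fderiv_of_eq_inner (volume : Measure (E N)) (F' := ℝ)
      (p := 2) (p' := q) (hφ.of_le (by exact_mod_cast le_top)) hc (by norm_num)
      (by rw [finrank_euclideanSpace_fin]; omega)
      (by rw [finrank_euclideanSpace_fin, hq, inv_inv]; rfl)
    rw [eLpNorm_congr_ae h1, Lp.enorm_def, eLpNorm_congr_ae h2]
    have hsupp : Function.support (fun x => ‖fderiv ℝ φ x‖) ⊆ Ω := fun x hx =>
      hs (support_fderiv_subset ℝ fun h => hx (by simp [h]))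
    have e1 : eLpNorm (fun x => ‖fderiv ℝ φ x‖) 2 (volume.restrict Ω) =
        eLpNorm (fun x => ‖fderiv ℝ φ x‖) 2 volume :=
      eLpNorm_restrict_eq_of_support_subset hsupp
    have e2 : eLpNorm (gradient φ) 2 (volume.restrict Ω) =
        eLpNorm (fun x => ‖fderiv ℝ φ x‖) 2 (volume.restrict Ω) :=
      eLpNorm_congr_norm_ae (Eventually.of_forall fun x => by simp [gradient])
    rw [e2, e1, eLpNorm_norm]
    exact (eLpNorm_restrict_le _ _ _ _).trans hsob

theorem H10.grad_injective (hN : 3 ≤ N) : Function.Injective (H10.grad (Ω := Ω)) := by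
  rw [injective_iff_map_eq_zero]
  rintro ⟨⟨u, g⟩, hu⟩ (rfl : g = 0)
  suffices u = 0 by subst this; rfl
  obtain ⟨q, C, hq, hC⟩ := exists_sobolev_testPairs (Ω := Ω) hN
  obtain ⟨p, hp, hlim⟩ := mem_closure_iff_seq_limit.1 hu
  rw [Prod.tendsto_iff] at hlim
  have hm1 := tendstoInMeasure_of_tendsto_Lp hlim.1
  have hg : Tendsto (fun n => (C : ℝ≥0∞) * ‖(p n).2‖ₑ) atTop (𝓝 0) := by
    have := ENNReal.Tendsto.const_mul (a := (C : ℝ≥0∞)) hlim.2.enorm (Or.inr ENNReal.coe_ne_top)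
    simpa using this
  have hm2 : TendstoInMeasure (volume.restrict Ω) (fun n => ((p n).1 : E N → ℝ)) atTop
      (fun _ : E N => (0 : ℝ)) := by
    refine tendstoInMeasure_of_tendsto_eLpNorm (p := q) (by exact_mod_cast hq)
      (fun n => (Lp.aestronglyMeasurable _)) aestronglyMeasurable_const ?_
    refine tendsto_of_tendsto_of_tendsto_of_le_of_le tendsto_const_nhds hg
      (fun _ => zero_le) fun n => ?_
    have e : ((p n).1 : E N → ℝ) - (fun _ : E N => (0 : ℝ)) = (p n).1 := by
      funext x
      simp
    simpa only [e] using hC (p n) (hp n)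
  have := tendstoInMeasure_ae_unique hm1 hm2
  exact Lp.ext (this.trans (Lp.coeFn_zero _ _ _).symm)

/-- The norm `‖u‖ = (∫_Ω |∇u|²)^(1/2)` on `H¹₀(Ω)`. -/
instance [hN : Fact (3 ≤ N)] : NormedAddCommGroup (H10 Ω) :=
  NormedAddCommGroup.induced _ _ H10.grad (H10.grad_injective hN.out)

/-- The scalar product `⟨u, w⟩ = ∫_Ω ∇u · ∇w` on `H¹₀(Ω)`. -/
instance [Fact (3 ≤ N)] : InnerProductSpace ℝ (H10 Ω) where
  inner u w := inner ℝ (H10.grad u) (H10.grad w)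
  norm_smul_le c u := by
    change ‖H10.grad (c • u)‖ ≤ ‖c‖ * ‖H10.grad u‖
    rw [map_smul]
    exact norm_smul_le c _
  norm_sq_eq_re_inner u := norm_sq_eq_re_inner (𝕜 := ℝ) (H10.grad u)
  conj_inner_symm u w := inner_conj_symm (𝕜 := ℝ) (H10.grad u) (H10.grad w)
  add_left u v w := by rw [map_add, inner_add_left]
  smul_left u w c := by rw [map_smul, inner_smul_left]

/-! ### The Sobolev constant, the critical functional and the Palais-Smale condition -/

/-- The Sobolev exponent `2* = 2N / (N - 2)`. -/
def sobolevExponent (N : ℕ) : ℝ := 2 * N / (N - 2)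

/-- The best constant `S` of the embedding `H¹₀(Ω) ⊂ L^{2*}(Ω)`, that is, the largest `S` such that
`S (∫_Ω |u|^{2*})^{2/2*} ≤ ∫_Ω |∇u|²` for all `u` in `H¹₀(Ω)`. -/
def sobolevConstant (Ω : Set (E N)) : ℝ :=
  sInf {r : ℝ | ∃ u : H10 Ω, u ≠ 0 ∧
    r = (∫ x in Ω, ‖u.grad x‖ ^ 2) /
      (∫ x in Ω, |u.toL2 x| ^ sobolevExponent N) ^ (2 / sobolevExponent N)}

/-- The critical functional
`I_*(v) = 1/2 ∫_Ω |∇v|² - 1/(2·2*) ∫_Ω |f(v)|^{2·2*}` on `H¹₀(Ω)`. -/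
def criticalFunctional (Ω : Set (E N)) (v : H10 Ω) : ℝ :=
  1 / 2 * (∫ x in Ω, ‖v.grad x‖ ^ 2) -
    1 / (2 * sobolevExponent N) *
      ∫ x in Ω, |changeVar (v.toL2 x)| ^ (2 * sobolevExponent N)

/-- `I` satisfies the Palais-Smale condition on `H` at level `d`: every sequence `u` with
`I (u n) → d`, and with `I' (u n) → 0` in the dual space, has a convergent subsequence. -/
def SatisfiesPalaisSmale {H : Type*} [NormedAddCommGroup H] [NormedSpace ℝ H]
    (I : H → ℝ) (d : ℝ) : Prop :=
  ∀ u : ℕ → H, Tendsto (fun n => I (u n)) atTop (𝓝 d) →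
    Tendsto (fun n => fderiv ℝ I (u n)) atTop (𝓝 (0 : H →L[ℝ] ℝ)) →
    ∃ (v : H) (k : ℕ → ℕ), StrictMono k ∧ Tendsto (fun n => u (k n)) atTop (𝓝 v)

end QuasilinearPS

end

noncomputable section

namespace QuasilinearPS

/-! ### Growth of the change of variable -/

/-! Write `p` for `2*` and `c` for `slopeCoeff p`, that is `2^(p/2-1)`. At infinity `f(t)²` behaves
like `√2 |t|`, so `|f(t)|^{2p}` behaves like `2c |t|^p`: up to lower order terms, `I_*` is a
classical critical functional with coefficient `c`, and its loss of compactness is measured by the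
Sobolev constant.

The inequality `f² ≤ 2 t f f'` gives `density p t ≤ 2 t · slope p t`, whence `I(v) - I'(v)v / p ≥
‖v‖²/N` (`norm_sq_div_le_criticalFunctional_sub`). A Palais-Smale sequence is therefore bounded.
Along a subsequence `u n = a n + v`, where `a n` tends to `0` weakly and, by Rellich's theorem,
almost everywhere (`H10.exists_subseq`).

Brezis-Lieb type splittings (`tendsto_integral_split` with the pointwise estimates of "Splitting
estimates") separate the contributions of `a n` and `v`. They show that `I'(v)v = 0`, hence `I(v) ≥
0`, and that `‖a n‖²` and `c ∫ |a n|^p` have the same limit `b = N (d - I(v))`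
(`tendsto_of_palaisSmale`). Sobolev's inequality passes to the limit as `S (b/c)^(2/p) ≤ b`. Since
`c^(2/p) ≤ 2`, either `b = 0`, which is strong convergence, or `b ≥ (S/2)^(N/2)`. The latter forces
`d ≥ b/N ≥ (1/N)(S/2)^(N/2)`, which the bound on `d` excludes. -/

theorem le_of_hasDerivAt_nonneg {φ φ' : ℝ → ℝ} (h : ∀ x, HasDerivAt φ (φ' x) x)
    (h0 : ∀ x, 0 ≤ x → 0 ≤ φ' x) {s : ℝ} (hs : 0 ≤ s) : φ 0 ≤ φ s := by
  have hm : MonotoneOn φ (Set.Ici 0) := by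
    refine monotoneOn_of_deriv_nonneg (convex_Ici 0)
      (fun x _ => (h x).continuousAt.continuousWithinAt)
      (fun x _ => (h x).differentiableAt.differentiableWithinAt) fun x hx => ?_
    rw [(h x).deriv]
    rw [interior_Ici] at hx
    exact h0 x (le_of_lt hx)
  exact hm Set.self_mem_Ici hs hs

theorem primitiveSqrt_zero : primitiveSqrt 0 = 0 := by simp [primitiveSqrt]

/-- Integrated form of `√(1 + 2x²) ≤ 1 + √2 x`. With the next lemma it identifies the quadratic
growth of `primitiveSqrt`. -/
theorem primitiveSqrt_le {s : ℝ} (hs : 0 ≤ s) : primitiveSqrt s ≤ s + s ^ 2 / √2 := by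
  have h2 : (0 : ℝ) < √2 := by positivity
  have h22 : √2 * √2 = (2 : ℝ) := Real.mul_self_sqrt (by norm_num)
  have h := le_of_hasDerivAt_nonneg
    (φ := fun x => x + x ^ 2 / √2 - primitiveSqrt x)
    (φ' := fun x => 1 + (2 * x) / √2 - √(1 + 2 * x ^ 2)) (fun x => by
      have := ((hasDerivAt_id x).add (((hasDerivAt_id x).pow 2).div_const (√2))).sub
        (hasDerivAt_primitiveSqrt x)
      refine this.congr_deriv ?_
      simp) (fun x hx => by
      have e : (2 * x) / √2 = √2 * x := by field_simp; nlinarith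
      rw [e, sub_nonneg]
      apply Real.sqrt_le_iff.2
      constructor
      · positivity
      · nlinarith [mul_nonneg h2.le hx]) hs
  simp [primitiveSqrt_zero] at h
  linarith

theorem sq_div_sqrt_two_le_primitiveSqrt {s : ℝ} (hs : 0 ≤ s) : s ^ 2 / √2 ≤ primitiveSqrt s := by
  have h22 : √2 * √2 = (2 : ℝ) := Real.mul_self_sqrt (by norm_num)
  have h := le_of_hasDerivAt_nonneg
    (φ := fun x => primitiveSqrt x - x ^ 2 / √2)
    (φ' := fun x => √(1 + 2 * x ^ 2) - (2 * x) / √2) (fun x => by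
      have := (hasDerivAt_primitiveSqrt x).sub (((hasDerivAt_id x).pow 2).div_const (√2))
      refine this.congr_deriv ?_
      simp) (fun x hx => by
      have e : (2 * x) / √2 = √2 * x := by field_simp; nlinarith
      rw [e, sub_nonneg]
      apply Real.le_sqrt_of_sq_le
      nlinarith) hs
  simp [primitiveSqrt_zero] at h
  linarith

/-- The derivative of `s √(1 + 2s²)` is at most `2 √(1 + 2s²)`. At `s = f(t)` with `t ≥ 0` this
reads `f(t) ≤ 2 t f'(t)`, the source of the Ambrosetti-Rabinowitz inequality. -/
theorem half_mul_sqrt_le_primitiveSqrt {s : ℝ} (hs : 0 ≤ s) :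
    s * √(1 + 2 * s ^ 2) / 2 ≤ primitiveSqrt s := by
  have h := le_of_hasDerivAt_nonneg
    (φ := fun x => primitiveSqrt x - x * √(1 + 2 * x ^ 2) / 2)
    (φ' := fun x => √(1 + 2 * x ^ 2) - (√(1 + 2 * x ^ 2) + x * (4 * x / (2 * √(1 + 2 * x ^ 2)))) / 2)
    (fun x => by
      have h1 : HasDerivAt (fun x : ℝ => 1 + 2 * x ^ 2) (4 * x) x := by
        have := ((hasDerivAt_id x).pow 2).const_mul 2 |>.const_add 1
        refine this.congr_deriv ?_
        simp
        ring
      have h2 := h1.sqrt (by positivity)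
      have := (hasDerivAt_primitiveSqrt x).sub (((hasDerivAt_id x).mul h2).div_const 2)
      refine this.congr_deriv ?_
      simp) (fun x hx => by
      have hp := integrand_pos x
      have hq : √(1 + 2 * x ^ 2) * √(1 + 2 * x ^ 2) = 1 + 2 * x ^ 2 :=
        Real.mul_self_sqrt (by positivity)
      have : x * (4 * x / (2 * √(1 + 2 * x ^ 2))) ≤ √(1 + 2 * x ^ 2) := by
        rw [← mul_div_assoc, div_le_iff₀ (by positivity)]
        nlinarith
      linarith) hs
  simp [primitiveSqrt_zero] at h
  linarith

theorem changeVar_zero : changeVar 0 = 0 := by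
  have := changeVar_neg 0
  simp at this
  linarith

theorem strictMono_changeVar : StrictMono changeVar :=
  (strictMono_primitiveSqrt.orderIsoOfSurjective primitiveSqrt
    surjective_primitiveSqrt).symm.strictMono

theorem tendsto_changeVar_atTop : Tendsto changeVar atTop atTop :=
  (strictMono_primitiveSqrt.orderIsoOfSurjective primitiveSqrt
    surjective_primitiveSqrt).symm.tendsto_atTop

theorem changeVar_nonneg {t : ℝ} (ht : 0 ≤ t) : 0 ≤ changeVar t := by
  rw [← changeVar_zero]
  exact strictMono_changeVar.monotone ht

theorem abs_changeVar (t : ℝ) : |changeVar t| = changeVar |t| := by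
  rcases le_total 0 t with h | h
  · rw [abs_of_nonneg h, abs_of_nonneg (changeVar_nonneg h)]
  · have h' := changeVar_nonneg (neg_nonneg.2 h)
    rw [changeVar_neg] at h'
    rw [abs_of_nonpos h, changeVar_neg, abs_of_nonpos (by linarith)]

theorem primitiveSqrt_abs_changeVar (t : ℝ) : primitiveSqrt |changeVar t| = |t| := by
  rw [abs_changeVar, primitiveSqrt_changeVar]

theorem changeVar_sq_le (t : ℝ) : changeVar t ^ 2 ≤ √2 * |t| := by
  have h := sq_div_sqrt_two_le_primitiveSqrt (abs_nonneg (changeVar t))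
  rwa [primitiveSqrt_abs_changeVar, sq_abs, div_le_iff₀' (by positivity)] at h

theorem changeVar_sq_le_mul_deriv (t : ℝ) :
    changeVar t ^ 2 ≤ 2 * (t * (changeVar t * (1 / √(1 + 2 * changeVar t ^ 2)))) := by
  have hp := integrand_pos (changeVar t)
  have h := half_mul_sqrt_le_primitiveSqrt (abs_nonneg (changeVar t))
  rw [primitiveSqrt_abs_changeVar, sq_abs] at h
  have e : t * changeVar t = |t| * |changeVar t| := by
    rw [← abs_mul]
    refine (abs_of_nonneg ?_).symm
    rcases le_total 0 t with h | h
    · exact mul_nonneg h (changeVar_nonneg h)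
    · have h' := changeVar_nonneg (neg_nonneg.2 h)
      rw [changeVar_neg] at h'
      nlinarith
  have e2 : 2 * (t * (changeVar t * (1 / √(1 + 2 * changeVar t ^ 2)))) =
      2 * (|t| * |changeVar t|) / √(1 + 2 * changeVar t ^ 2) := by
    rw [← e]; ring
  rw [e2, le_div_iff₀ hp, ← sq_abs]
  rw [← sq_abs] at h
  nlinarith [abs_nonneg (changeVar t)]

/-! ### The nonlinearity of the critical functional -/

/-- The density `|f(t)|^{2p}`. -/
def density (p t : ℝ) : ℝ := |changeVar t| ^ (2 * p)

/-- The function `|f(t)|^{2p-2} f(t) f'(t)`, which is `1/(2p)` times the derivative of the density. -/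
def slope (p t : ℝ) : ℝ :=
  |changeVar t| ^ (2 * p - 2) * (changeVar t * (1 / √(1 + 2 * changeVar t ^ 2)))

/-- The coefficient `2^{p/2-1}` of `|t|^{p-2} t` in the slope at infinity. -/
def slopeCoeff (p : ℝ) : ℝ := 2 ^ (p / 2 - 1)

theorem slopeCoeff_pos (p : ℝ) : 0 < slopeCoeff p := by unfold slopeCoeff; positivity

/-- The coefficient of `|t|^p` in the density at infinity, coming from `f² ~ √2 |t|`. -/
theorem sqrt_two_rpow (p : ℝ) : √2 ^ p = 2 * slopeCoeff p := by
  rw [slopeCoeff, Real.sqrt_eq_rpow, ← Real.rpow_mul (by norm_num),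
    Real.rpow_sub_one (by norm_num)]
  rw [mul_div_cancel₀ _ (by norm_num)]
  congr 1; ring

variable {p : ℝ}

theorem abs_rpow_two_mul (s q : ℝ) : |s| ^ (2 * q) = (s ^ 2) ^ q := by
  rw [Real.rpow_mul (abs_nonneg _), Real.rpow_two, sq_abs]

theorem density_nonneg (p t : ℝ) : 0 ≤ density p t := by unfold density; positivity

theorem density_le (hp : 0 ≤ p) (t : ℝ) : density p t ≤ 2 * slopeCoeff p * |t| ^ p := by
  rw [density, abs_rpow_two_mul, ← sqrt_two_rpow, ← Real.mul_rpow (by positivity) (abs_nonneg _)]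
  exact Real.rpow_le_rpow (sq_nonneg _) (changeVar_sq_le t) hp

theorem density_le_mul_slope (hp : 1 < p) (t : ℝ) : density p t ≤ 2 * (t * slope p t) := by
  have h := changeVar_sq_le_mul_deriv t
  have e : density p t = |changeVar t| ^ (2 * p - 2) * changeVar t ^ 2 := by
    rw [density, ← sq_abs (changeVar t), ← Real.rpow_two,
      ← Real.rpow_add_of_nonneg (abs_nonneg _) (by linarith) (by norm_num)]
    congr 1; ring
  rw [e, slope]
  have := mul_le_mul_of_nonneg_left h (Real.rpow_nonneg (abs_nonneg (changeVar t)) (2 * p - 2))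
  linarith

theorem abs_mul_inv_sqrt_le (s : ℝ) : |s * (1 / √(1 + 2 * s ^ 2))| ≤ 1 / √2 := by
  rw [abs_mul, abs_of_pos (one_div_pos.2 (integrand_pos s)), mul_one_div,
    div_le_div_iff₀ (integrand_pos s) (by positivity), one_mul, ← Real.sqrt_sq_eq_abs,
    ← Real.sqrt_mul (sq_nonneg s)]
  exact Real.sqrt_le_sqrt (by linarith)

/-- The factor `|f|^{2p-2} = (f²)^{p-1}` is at most `(√2 |t|)^{p-1}`, and `|f f'| ≤ 1/√2`. -/
theorem abs_slope_le (hp : 1 ≤ p) (t : ℝ) : |slope p t| ≤ slopeCoeff p * |t| ^ (p - 1) := by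
  have e : slopeCoeff p = √2 ^ (p - 1) * (1 / √2) := by
    rw [Real.rpow_sub_one (by positivity), sqrt_two_rpow]
    have : √2 * √2 = (2 : ℝ) := Real.mul_self_sqrt (by norm_num)
    field_simp
    rw [sq, this]
  have e2 : 2 * p - 2 = 2 * (p - 1) := by ring
  rw [slope, abs_mul, abs_of_nonneg (by positivity), e, e2, abs_rpow_two_mul]
  calc _ ≤ (√2 * |t|) ^ (p - 1) * (1 / √2) := by
        gcongr
        · exact changeVar_sq_le t
        · exact abs_mul_inv_sqrt_le _
    _ = _ := by rw [Real.mul_rpow (by positivity) (abs_nonneg _)]; ring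

theorem mul_slope_le (hp : 1 < p) (t : ℝ) : t * slope p t ≤ slopeCoeff p * |t| ^ p := by
  calc t * slope p t ≤ |t| * |slope p t| := by rw [← abs_mul]; exact le_abs_self _
    _ ≤ |t| * (slopeCoeff p * |t| ^ (p - 1)) := by gcongr; exact abs_slope_le hp.le t
    _ = slopeCoeff p * (|t| ^ (p - 1) * |t| ^ (1 : ℝ)) := by rw [Real.rpow_one]; ring
    _ = _ := by
      rw [← Real.rpow_add_of_nonneg (abs_nonneg _) (by linarith) zero_le_one, sub_add_cancel]

theorem hasDerivAt_density (hp : 1 < p) (t : ℝ) :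
    HasDerivAt (density p) (2 * p * slope p t) t := by
  have h := (hasDerivAt_abs_rpow (changeVar t) (p := 2 * p) (by linarith)).comp t
    (hasDerivAt_changeVar t)
  refine h.congr_deriv ?_
  rw [slope]; ring

theorem continuous_density (hp : 1 < p) : Continuous (density p) :=
  continuous_iff_continuousAt.2 fun t => (hasDerivAt_density hp t).continuousAt

/-- With `y = (f f')²` the derivative equals `|f|^{2p-4} ((2p-1) y - 2y²)`. As `0 ≤ y ≤ 1`, the
growth is that of `(f²)^{p-2} ≤ (√2 |t|)^{p-2}`. -/
theorem exists_hasDerivAt_slope (hp : 2 < p) : ∃ g' : ℝ → ℝ, ∃ C, 0 ≤ C ∧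
    (∀ t, HasDerivAt (slope p) (g' t) t) ∧ ∀ t, |g' t| ≤ C * |t| ^ (p - 2) := by
  -- The witness is the unsimplified output of the product, quotient and chain rules, so that
  -- differentiability closes without rewriting; `e4` simplifies it afterwards.
  refine ⟨fun t => ((2 * p - 2) * |changeVar t| ^ (2 * p - 2 - 2) * changeVar t
        * (1 / √(1 + 2 * changeVar t ^ 2))) * (changeVar t * (1 / √(1 + 2 * changeVar t ^ 2))) +
      |changeVar t| ^ (2 * p - 2) *
        ((1 / √(1 + 2 * changeVar t ^ 2)) * (1 / √(1 + 2 * changeVar t ^ 2)) + changeVar t *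
        ((0 * √(1 + 2 * changeVar t ^ 2) - 1 * ((4 * changeVar t * (1 / √(1 + 2 * changeVar t ^ 2)))
          / (2 * √(1 + 2 * changeVar t ^ 2)))) / √(1 + 2 * changeVar t ^ 2) ^ 2)),
    (2 * p + 2) * √2 ^ (p - 2), by positivity, fun t => ?_, fun t => ?_⟩
  · have hf := hasDerivAt_changeVar t
    have h1 := (hasDerivAt_abs_rpow (changeVar t) (p := 2 * p - 2) (by linarith)).comp t hf
    have h2 : HasDerivAt (fun t => 1 + 2 * changeVar t ^ 2)
        (4 * changeVar t * (1 / √(1 + 2 * changeVar t ^ 2))) t := by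
      refine (((hf.pow 2).const_mul 2).const_add 1).congr_deriv ?_
      simp; ring
    have h3 := h2.sqrt (by positivity)
    have h4 := (hasDerivAt_const t (1 : ℝ)).div h3 (integrand_pos (changeVar t)).ne'
    exact h1.mul (hf.mul h4)
  · beta_reduce
    have hD := integrand_pos (changeVar t)
    have hq := changeVar_sq_le t
    generalize changeVar t = s at *
    have hD2 : √(1 + 2 * s ^ 2) ^ 2 = 1 + 2 * s ^ 2 := Real.sq_sqrt (by positivity)
    generalize √(1 + 2 * s ^ 2) = D at *
    have e0 : |s| ^ (2 * p - 2) = |s| ^ (2 * p - 2 - 2) * s ^ 2 := by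
      rw [← sq_abs s, ← Real.rpow_two,
        ← Real.rpow_add_of_nonneg (abs_nonneg _) (by linarith) (by norm_num)]
      congr 1; ring
    have e1 : |s| ^ (2 * p - 2 - 2) ≤ √2 ^ (p - 2) * |t| ^ (p - 2) := by
      rw [show 2 * p - 2 - 2 = 2 * (p - 2) by ring, abs_rpow_two_mul,
        ← Real.mul_rpow (by positivity) (abs_nonneg _)]
      exact Real.rpow_le_rpow (sq_nonneg _) hq (by linarith)
    have e2 : s ^ 2 / D ^ 2 ≤ 1 := by
      rw [div_le_one (by positivity)]; nlinarith
    have e3 : 0 ≤ s ^ 2 / D ^ 2 := by positivity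
    rw [e0]
    set A := |s| ^ (2 * p - 2 - 2) with hA
    have hA0 : 0 ≤ A := by positivity
    set y := s ^ 2 / D ^ 2 with hy
    have e4 : (2 * p - 2) * A * s * (1 / D) * (s * (1 / D)) + A * s ^ 2 *
        (1 / D * (1 / D) + s * ((0 * D - 1 * (4 * s * (1 / D) / (2 * D))) / D ^ 2)) =
        A * ((2 * p - 1) * y - 2 * y ^ 2) := by
      rw [hy]; field_simp; ring
    rw [e4, abs_mul, abs_of_nonneg hA0]
    have e5 : |(2 * p - 1) * y - 2 * y ^ 2| ≤ 2 * p + 2 := by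
      rw [abs_le]; constructor <;> nlinarith
    calc A * _ ≤ A * (2 * p + 2) := by gcongr
      _ ≤ (√2 ^ (p - 2) * |t| ^ (p - 2)) * (2 * p + 2) := by gcongr
      _ = _ := by ring

theorem continuous_slope (hp : 2 < p) : Continuous (slope p) := by
  obtain ⟨g', C, -, h, -⟩ := exists_hasDerivAt_slope hp
  exact continuous_iff_continuousAt.2 fun t => (h t).continuousAt

/-! ### Behaviour of the density at infinity. -/

theorem tendsto_primitiveSqrt_div_sq :
    Tendsto (fun s => primitiveSqrt s / s ^ 2) atTop (𝓝 (1 / √2)) := by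
  have h1 : Tendsto (fun s : ℝ => 1 / √2 + s⁻¹) atTop (𝓝 (1 / √2)) := by
    simpa using tendsto_inv_atTop_zero.const_add (1 / √2)
  refine tendsto_of_tendsto_of_tendsto_of_le_of_le' tendsto_const_nhds h1 ?_ ?_
  · filter_upwards [eventually_gt_atTop 0] with s hs
    rw [le_div_iff₀ (by positivity)]
    have := sq_div_sqrt_two_le_primitiveSqrt hs.le
    simpa [one_div, inv_mul_eq_div] using this
  · filter_upwards [eventually_gt_atTop 0] with s hs
    rw [div_le_iff₀ (by positivity)]
    have := primitiveSqrt_le hs.le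
    refine this.trans_eq ?_
    field_simp
    ring

/-- With `s = f(t)`, so that `t = primitiveSqrt s`, the quotient is `(s² / primitiveSqrt s)^p`. -/
theorem tendsto_density_div_rpow (hp : 0 < p) :
    Tendsto (fun t => density p t / t ^ p) atTop (𝓝 (2 * slopeCoeff p)) := by
  have h := ((tendsto_primitiveSqrt_div_sq.comp tendsto_changeVar_atTop).inv₀
    (by positivity)).rpow_const (p := p) (Or.inr hp.le)
  rw [one_div, inv_inv, sqrt_two_rpow] at h
  refine h.congr' ?_
  filter_upwards [eventually_gt_atTop 0] with t ht
  simp only [Function.comp, primitiveSqrt_changeVar, inv_div]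
  rw [density, abs_rpow_two_mul, Real.div_rpow (sq_nonneg _) ht.le]

/-- Converse of `density_le` up to `ε |t|^p` and a constant: the limit at infinity handles large
`|t|`, and the constant absorbs a bounded range. -/
theorem exists_le_density (hp : 1 < p) {ε : ℝ} (hε : 0 < ε) :
    ∃ C, 0 ≤ C ∧ ∀ t, 2 * slopeCoeff p * |t| ^ p ≤ density p t + ε * |t| ^ p + C := by
  have h := (tendsto_density_div_rpow (p := p) (by linarith)).eventually
    (lt_mem_nhds (show 2 * slopeCoeff p - ε < 2 * slopeCoeff p by linarith))
  obtain ⟨T, hT⟩ := (h.and (eventually_gt_atTop 0)).exists_forall_of_atTop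
  have hc := slopeCoeff_pos p
  refine ⟨2 * slopeCoeff p * |T| ^ p, by positivity, fun t => ?_⟩
  have hev : density p t = density p |t| := by
    rw [density, density, ← abs_changeVar, abs_abs]
  have h0 := density_nonneg p t
  have h1 : 0 ≤ ε * |t| ^ p := by positivity
  have h2 : 0 ≤ 2 * slopeCoeff p * |T| ^ p := by positivity
  rcases le_total T |t| with ht | ht
  · obtain ⟨h3, h4⟩ := hT _ ht
    rw [lt_div_iff₀ (by positivity), ← hev] at h3
    linarith
  · have : |t| ^ p ≤ |T| ^ p :=
      Real.rpow_le_rpow (abs_nonneg _) (ht.trans (le_abs_self _)) (by linarith)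
    nlinarith

/-! ### Splitting estimates -/

/-- `(|a| + |b|)^{p-1} |b|` is negligible with respect to `|a|^p`, up to a multiple of `|b|^p`. -/
theorem exists_add_rpow_mul_le (hp : 1 < p) {ε : ℝ} (hε : 0 < ε) :
    ∃ C, 0 ≤ C ∧ ∀ a b : ℝ, (|a| + |b|) ^ (p - 1) * |b| ≤ ε * |a| ^ p + C * |b| ^ p := by
  have hmul : ∀ x : ℝ, 0 ≤ x → x ^ (p - 1) * x = x ^ p := fun x hx => by
    conv_lhs => rw [← Real.rpow_one x, ← Real.rpow_mul hx, one_mul]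
    rw [← Real.rpow_add_of_nonneg hx (by linarith) zero_le_one, sub_add_cancel]
  -- The cases are `|b| ≤ δ |a|` and its opposite. The bound `δ ≤ 1` gives `|a| + |b| ≤ 2 |a|` in
  -- the first; the other bound on `δ` absorbs the resulting factor `2^(p-1)` into `ε`.
  set δ := min 1 (ε / 2 ^ (p - 1)) with hδ
  have hδ0 : 0 < δ := by positivity
  refine ⟨(1 / δ + 1) ^ (p - 1), by positivity, fun a b => ?_⟩
  have ha := abs_nonneg a
  have hb := abs_nonneg b
  generalize |a| = x at *
  generalize |b| = y at *
  rcases le_total y (δ * x) with h | h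
  · have h1 : x + y ≤ 2 * x := by nlinarith [min_le_left 1 (ε / 2 ^ (p - 1))]
    calc (x + y) ^ (p - 1) * y ≤ (2 * x) ^ (p - 1) * (δ * x) := by gcongr
      _ = 2 ^ (p - 1) * δ * (x ^ (p - 1) * x) := by
        rw [Real.mul_rpow (by norm_num) ha]; ring
      _ ≤ 2 ^ (p - 1) * (ε / 2 ^ (p - 1)) * x ^ p := by
        rw [hmul x ha]; gcongr; exact min_le_right _ _
      _ = ε * x ^ p := by field_simp
      _ ≤ _ := by have : 0 ≤ (1 / δ + 1) ^ (p - 1) * y ^ p := by positivity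
                  linarith
  · have h1 : x + y ≤ (1 / δ + 1) * y := by
      have : x ≤ 1 / δ * y := by rw [one_div, inv_mul_eq_div, le_div_iff₀ hδ0]; linarith
      linarith
    calc (x + y) ^ (p - 1) * y ≤ ((1 / δ + 1) * y) ^ (p - 1) * y := by gcongr
      _ = (1 / δ + 1) ^ (p - 1) * (y ^ (p - 1) * y) := by
        rw [Real.mul_rpow (by positivity) hb]; ring
      _ ≤ _ := by
        rw [hmul y hb]
        have : 0 ≤ ε * x ^ p := by positivity
        linarith

theorem abs_le_of_mem_closedBall {u w x : ℝ} (hx : x ∈ Metric.closedBall u |w|) :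
    |x| ≤ |u| + |w| := by
  rw [Metric.mem_closedBall, Real.dist_eq] at hx
  have := abs_sub_abs_le_abs_sub x u
  linarith

/-- A mean value inequality for functions whose derivative has the growth `|t|^q`. -/
theorem abs_sub_le_of_hasDerivAt {F F' : ℝ → ℝ} {C q : ℝ} (hC : 0 ≤ C) (hq : 0 ≤ q)
    (h : ∀ t, HasDerivAt F (F' t) t) (hb : ∀ t, |F' t| ≤ C * |t| ^ q) (u w : ℝ) :
    ∀ x ∈ Metric.closedBall u |w|, |F x - F u| ≤ C * (|u| + |w|) ^ q * |x - u| := by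
  intro x hx
  have := (convex_closedBall u |w|).norm_image_sub_le_of_norm_hasDerivWithin_le
    (f := F) (f' := F') (C := C * (|u| + |w|) ^ q)
    (fun y _ => (h y).hasDerivWithinAt) (fun y hy => (hb y).trans (by
      gcongr; exact abs_le_of_mem_closedBall hy)) (Metric.mem_closedBall_self (abs_nonneg w)) hx
  simpa [Real.norm_eq_abs] using this

theorem add_mem_closedBall_abs (u w : ℝ) : u + w ∈ Metric.closedBall u |w| := by simp

theorem exists_abs_slope_sub_le (hp : 2 < p) : ∃ C, 0 ≤ C ∧ ∀ u w : ℝ,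
    ∀ x ∈ Metric.closedBall u |w|,
      |slope p x - slope p u| ≤ C * (|u| + |w|) ^ (p - 2) * |x - u| := by
  obtain ⟨g', C, hC, h, hb⟩ := exists_hasDerivAt_slope hp
  exact ⟨C, hC, abs_sub_le_of_hasDerivAt hC (by linarith) h hb⟩

/-- Second order Taylor estimate for the density. -/
theorem exists_density_taylor_le (hp : 2 < p) : ∃ C, 0 ≤ C ∧ ∀ u w : ℝ,
    |density p (u + w) - density p u - 2 * p * slope p u * w| ≤
      C * ((|u| + |w|) ^ (p - 2) * w ^ 2) := by
  obtain ⟨C, hC, h⟩ := exists_abs_slope_sub_le hp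
  refine ⟨2 * p * C, by positivity, fun u w => ?_⟩
  -- Mean value inequality for the density minus its linear part at `u`, whose derivative is a
  -- difference of slopes.
  have := (convex_closedBall u |w|).norm_image_sub_le_of_norm_hasDerivWithin_le
    (f := fun x => density p x - 2 * p * slope p u * x)
    (f' := fun x => 2 * p * slope p x - 2 * p * slope p u)
    (C := 2 * p * (C * (|u| + |w|) ^ (p - 2) * |w|))
    (fun y _ => by
      have := ((hasDerivAt_density (by linarith : 1 < p) y).sub
        ((hasDerivAt_id y).const_mul (2 * p * slope p u)))
      rw [mul_one] at this
      exact this.hasDerivWithinAt) (fun y hy => by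
      rw [← mul_sub, Real.norm_eq_abs, abs_mul, abs_of_pos (by positivity)]
      gcongr
      refine (h u w y hy).trans ?_
      rw [Metric.mem_closedBall, Real.dist_eq] at hy
      exact mul_le_mul_of_nonneg_left hy (by positivity)) (Metric.mem_closedBall_self (abs_nonneg w))
      (add_mem_closedBall_abs u w)
  rw [Real.norm_eq_abs, add_sub_cancel_left, Real.norm_eq_abs] at this
  calc _ = |density p (u + w) - 2 * p * slope p u * (u + w) -
        (density p u - 2 * p * slope p u * u)| := by congr 1; ring
    _ ≤ _ := this
    _ = _ := by rw [← sq_abs w]; ring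

/-- Replacing `a + b` by `a` costs a multiple of `(|a| + |b|)^{p-1} |b|`, and replacing `density p
a` by `2c |a|^p` costs `ε/2 |a|^p` and a constant; `density p b` is of order `|b|^p`. -/
theorem exists_abs_density_split_le (hp : 1 < p) {ε : ℝ} (hε : 0 < ε) :
    ∃ C, 0 ≤ C ∧ ∀ a b : ℝ, |density p (a + b) - density p b - 2 * slopeCoeff p * |a| ^ p| ≤
      ε * |a| ^ p + C * (1 + |b| ^ p) := by
  have hc := slopeCoeff_pos p
  obtain ⟨C₁, hC₁, h₁⟩ := exists_le_density hp (half_pos hε)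
  obtain ⟨C₂, hC₂, h₂⟩ := exists_add_rpow_mul_le hp
    (show 0 < ε / 2 / (2 * p * slopeCoeff p) by positivity)
  refine ⟨C₁ + 2 * p * slopeCoeff p * C₂ + 2 * slopeCoeff p, by positivity, fun a b => ?_⟩
  have hd := abs_sub_le_of_hasDerivAt (F := density p) (C := 2 * p * slopeCoeff p) (q := p - 1)
    (by positivity) (by linarith) (hasDerivAt_density hp) (fun t => by
      rw [abs_mul, abs_of_pos (by positivity : 0 < 2 * p), mul_assoc (2 * p)]
      gcongr
      exact abs_slope_le hp.le t) a b _ (add_mem_closedBall_abs a b)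
  rw [add_sub_cancel_left, mul_assoc] at hd
  have h3 := mul_le_mul_of_nonneg_left (h₂ a b) (show 0 ≤ 2 * p * slopeCoeff p by positivity)
  have e : 2 * p * slopeCoeff p * (ε / 2 / (2 * p * slopeCoeff p) * |a| ^ p + C₂ * |b| ^ p) =
    ε / 2 * |a| ^ p + 2 * p * slopeCoeff p * C₂ * |b| ^ p := by field_simp
  rw [e] at h3
  have h4 := density_le (p := p) (by linarith) a
  have h5 := density_le (p := p) (by linarith) b
  have h6 := density_nonneg p b
  have h7 := h₁ a
  have h8 := abs_le.1 (hd.trans h3)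
  have ha : 0 ≤ |a| ^ p := by positivity
  have hb : 0 ≤ |b| ^ p := by positivity
  have hb1 : 0 ≤ C₁ * |b| ^ p := by positivity
  have hb2 : 0 ≤ 2 * p * slopeCoeff p * C₂ := by positivity
  have ha1 : 0 ≤ ε * |a| ^ p := by positivity
  rw [abs_le]
  constructor <;> nlinarith [h8.1, h8.2]

theorem abs_slope_add_mul_le (hp : 1 < p) (a b : ℝ) :
    |slope p (a + b) * b| ≤ slopeCoeff p * ((|a| + |b|) ^ (p - 1) * |b|) := by
  have hc := slopeCoeff_pos p
  rw [abs_mul, ← mul_assoc]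
  gcongr
  refine (abs_slope_le hp.le _).trans ?_
  gcongr
  exact abs_add_le a b

/-- No asymptotics of the slope are needed: `(a + b) · slope p (a + b)` lies between half of
`density p (a + b)` and `c |a + b|^p`, which both agree with `c |a|^p` up to negligible terms, and
`slope p (a + b) · b` is itself negligible. -/
theorem exists_abs_slope_mul_split_le (hp : 1 < p) {ε : ℝ} (hε : 0 < ε) :
    ∃ C, 0 ≤ C ∧ ∀ a b : ℝ, |slope p (a + b) * a - slopeCoeff p * |a| ^ p| ≤
      ε * |a| ^ p + C * (1 + |b| ^ p) := by
  have hc := slopeCoeff_pos p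
  obtain ⟨C₁, hC₁, h₁⟩ := exists_abs_density_split_le hp hε
  obtain ⟨C₂, hC₂, h₂⟩ := exists_add_rpow_mul_le hp
    (show 0 < ε / 2 / ((p + 1) * slopeCoeff p) by positivity)
  refine ⟨C₁ + (p + 1) * slopeCoeff p * C₂, by positivity, fun a b => ?_⟩
  have hpow := abs_sub_le_of_hasDerivAt (F := fun x => |x| ^ p) (C := p) (q := p - 1)
    (by linarith) (by linarith) (fun t => hasDerivAt_abs_rpow t hp) (fun t => by
      rw [abs_mul, abs_mul, abs_of_pos (by linarith : 0 < p), mul_assoc,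
        abs_of_nonneg (by positivity)]
      rcases eq_or_ne t 0 with rfl | ht
      · simp; positivity
      · rw [← Real.rpow_add_one (by simpa using ht)]
        refine le_of_eq ?_
        congr 2; ring) a b _ (add_mem_closedBall_abs a b)
  rw [add_sub_cancel_left, mul_assoc] at hpow
  have h3 := mul_le_mul_of_nonneg_left (h₂ a b) (show 0 ≤ (p + 1) * slopeCoeff p by positivity)
  have e : (p + 1) * slopeCoeff p * (ε / 2 / ((p + 1) * slopeCoeff p) * |a| ^ p + C₂ * |b| ^ p) =
    ε / 2 * |a| ^ p + (p + 1) * slopeCoeff p * C₂ * |b| ^ p := by field_simp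
  rw [e] at h3
  have h4 := abs_le.1 (abs_slope_add_mul_le hp a b)
  have h5 := mul_slope_le hp (a + b)
  have h6 := density_le_mul_slope hp (a + b)
  have h7 := (abs_le.1 (h₁ a b)).1
  have h8 := density_nonneg p b
  have h9 := mul_le_mul_of_nonneg_left (abs_le.1 hpow).2 hc.le
  set X := (|a| + |b|) ^ (p - 1) * |b| with hX
  have hX0 : 0 ≤ slopeCoeff p * X := by positivity
  have hX1 : 0 ≤ p * (slopeCoeff p * X) := by positivity
  have ha : 0 ≤ ε * |a| ^ p := by positivity
  have hb : 0 ≤ |b| ^ p := by positivity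
  have hb1 : 0 ≤ C₁ * |b| ^ p := by positivity
  have hb2 : 0 ≤ (p + 1) * slopeCoeff p * C₂ := by positivity
  rw [add_mul] at h5 h6
  rw [abs_le]
  constructor <;> nlinarith [h4.1, h4.2]

theorem exists_abs_slope_sub_mul_le (hp : 1 < p) {ε : ℝ} (hε : 0 < ε) :
    ∃ C, 0 ≤ C ∧ ∀ a b : ℝ, |(slope p (a + b) - slope p b) * b| ≤
      ε * |a| ^ p + C * (1 + |b| ^ p) := by
  have hc := slopeCoeff_pos p
  obtain ⟨C₂, hC₂, h₂⟩ := exists_add_rpow_mul_le hp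
    (show 0 < ε / slopeCoeff p by positivity)
  refine ⟨slopeCoeff p * C₂ + slopeCoeff p, by positivity, fun a b => ?_⟩
  have h3 := abs_slope_add_mul_le hp a b
  have h4 := abs_slope_add_mul_le hp 0 b
  rw [abs_zero, zero_add, zero_add, ← Real.rpow_add_one' (abs_nonneg b) (by linarith),
    sub_add_cancel] at h4
  have h5 := mul_le_mul_of_nonneg_left (h₂ a b) hc.le
  have e : slopeCoeff p * (ε / slopeCoeff p * |a| ^ p + C₂ * |b| ^ p) =
    ε * |a| ^ p + slopeCoeff p * C₂ * |b| ^ p := by field_simp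
  rw [e] at h5
  have h6 : 0 ≤ slopeCoeff p * C₂ := by positivity
  rw [sub_mul]
  refine (abs_sub _ _).trans ?_
  nlinarith

end QuasilinearPS

namespace QuasilinearPS

variable {N : ℕ} {Ω : Set (E N)}

/-! ### A convergence lemma of Brezis-Lieb type -/

/-- The positive part of `|F n| - ε W n` is dominated by `|H|` and tends to zero almost everywhere,
so its integral tends to zero; what remains is at most `ε K`. -/
theorem tendsto_integral_zero_of_abs_le {α : Type*} [MeasurableSpace α] {μ : Measure α}
    {F W : ℕ → α → ℝ} {K : ℝ} (hF : ∀ n, AEStronglyMeasurable (F n) μ)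
    (hW0 : ∀ n x, 0 ≤ W n x) (hW : ∀ n, Integrable (W n) μ) (hK : ∀ n, ∫ x, W n x ∂μ ≤ K)
    (hlim : ∀ᵐ x ∂μ, Tendsto (fun n => F n x) atTop (𝓝 0))
    (hb : ∀ ε > 0, ∃ H : α → ℝ, Integrable H μ ∧ ∀ n, ∀ᵐ x ∂μ, |F n x| ≤ ε * W n x + H x) :
    Tendsto (fun n => ∫ x, F n x ∂μ) atTop (𝓝 0) := by
  have hFi : ∀ n, Integrable (F n) μ := fun n => by
    obtain ⟨H, hH, h⟩ := hb 1 one_pos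
    exact (((hW n).const_mul 1).add hH).mono' (hF n) (h n)
  rw [Metric.tendsto_atTop]
  intro η hη
  have hK0 : 0 ≤ K := (integral_nonneg (hW0 0)).trans (hK 0)
  -- Dividing by `K + 1` rather than `K` covers `K = 0`.
  set ε := η / 2 / (K + 1) with hε
  have hε0 : 0 < ε := by positivity
  obtain ⟨H, hH, h⟩ := hb ε hε0
  have hDi : ∀ n, Integrable (fun x => max (|F n x| - ε * W n x) 0) μ := fun n =>
    ((hFi n).abs.sub ((hW n).const_mul ε)).pos_part
  have hD : Tendsto (fun n => ∫ x, max (|F n x| - ε * W n x) 0 ∂μ) atTop (𝓝 (∫ _, (0 : ℝ) ∂μ)) := by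
    refine tendsto_integral_of_dominated_convergence (fun x => |H x|)
      (fun n => (hDi n).aestronglyMeasurable) hH.abs (fun n => ?_) ?_
    · filter_upwards [h n] with x hx
      rw [Real.norm_eq_abs, abs_of_nonneg (le_max_right _ _)]
      exact max_le ((by linarith : _ ≤ H x).trans (le_abs_self _)) (abs_nonneg _)
    · filter_upwards [hlim] with x hx
      refine tendsto_of_tendsto_of_tendsto_of_le_of_le tendsto_const_nhds
        (by simpa using hx.abs) (fun n => le_max_right _ _) fun n => max_le ?_ (abs_nonneg _)
      have := mul_nonneg hε0.le (hW0 n x)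
      simp only
      linarith
  rw [integral_zero] at hD
  obtain ⟨M, hM⟩ := (hD.eventually (gt_mem_nhds (half_pos hη))).exists_forall_of_atTop
  refine ⟨M, fun n hn => ?_⟩
  rw [dist_zero_right]
  have h1 : ‖∫ x, F n x ∂μ‖ ≤ ∫ x, (max (|F n x| - ε * W n x) 0 + ε * W n x) ∂μ := by
    refine norm_integral_le_of_norm_le ((hDi n).add ((hW n).const_mul ε))
      (Eventually.of_forall fun x => ?_)
    have := le_max_left (|F n x| - ε * W n x) 0
    rw [Real.norm_eq_abs]
    linarith
  rw [integral_add (hDi n) ((hW n).const_mul ε), integral_const_mul] at h1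
  have h2 : ε * ∫ x, W n x ∂μ ≤ η / 2 := by
    calc _ ≤ ε * (K + 1) := by gcongr; linarith [hK n]
      _ = η / 2 := by rw [hε]; field_simp
  have := hM n hn
  linarith

/-! ### The Sobolev exponent -/

theorem two_lt_sobolevExponent (hN : 3 ≤ N) : 2 < sobolevExponent N := by
  have hN' : (3 : ℝ) ≤ N := by exact_mod_cast hN
  rw [sobolevExponent, lt_div_iff₀ (by linarith)]
  linarith

theorem sobolevExponent_pos (hN : 3 ≤ N) : 0 < sobolevExponent N := by
  linarith [two_lt_sobolevExponent hN]

theorem inv_sobolevExponent (hN : 3 ≤ N) : (sobolevExponent N)⁻¹ = 2⁻¹ - (N : ℝ)⁻¹ := by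
  have hN' : (3 : ℝ) ≤ N := by exact_mod_cast hN
  have : (N : ℝ) - 2 ≠ 0 := by linarith
  rw [sobolevExponent]
  field_simp

/-! ### The Sobolev inequality and density of test functions in `H¹₀(Ω)` -/

theorem H10.norm_eq [Fact (3 ≤ N)] (u : H10 Ω) : ‖u‖ = ‖u.grad‖ := rfl

theorem H10.norm_sq_eq_integral [Fact (3 ≤ N)] (u : H10 Ω) :
    ‖u‖ ^ 2 = ∫ x in Ω, ‖u.grad x‖ ^ 2 := by
  rw [H10.norm_eq, ← real_inner_self_eq_norm_sq, L2.inner_def]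
  simp_rw [real_inner_self_eq_norm_sq]

/-- Every element of `H¹₀(Ω)` is a limit of test functions, in `L²` and for the gradients. -/
theorem H10.exists_seq_test (u : H10 Ω) : ∃ (φ : ℕ → E N → ℝ) (w : ℕ → H10 Ω),
    (∀ n, IsTestFunction Ω (φ n)) ∧ (∀ n, (w n).toL2 =ᵐ[volume.restrict Ω] φ n) ∧
    (∀ n, (w n).grad =ᵐ[volume.restrict Ω] gradient (φ n)) ∧
    Tendsto (fun n => (w n).toL2) atTop (𝓝 u.toL2) ∧
    Tendsto (fun n => (w n).grad) atTop (𝓝 u.grad) := by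
  obtain ⟨p, hp, hlim⟩ := mem_closure_iff_seq_limit.1 u.2
  rw [Prod.tendsto_iff] at hlim
  choose φ h1 h2 h3 using id hp
  exact ⟨φ, fun n => ⟨p n, subset_closure (hp n)⟩, h1, h2, h3, hlim.1, hlim.2⟩

/-- The Gagliardo-Nirenberg-Sobolev inequality, applicable because `1/2* = 1/2 - 1/N`; the supports
in `Ω` make integrals over `Ω` and over the whole space agree. -/
theorem exists_eLpNorm_le_of_isTestFunction (hN : 3 ≤ N) : ∃ C : ℝ≥0,
    ∀ φ : E N → ℝ, IsTestFunction Ω φ → ∀ u : H10 Ω, u.toL2 =ᵐ[volume.restrict Ω] φ →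
      u.grad =ᵐ[volume.restrict Ω] gradient φ →
      eLpNorm u.toL2 (ENNReal.ofReal (sobolevExponent N)) (volume.restrict Ω) ≤ C * ‖u.grad‖ₑ := by
  have hp := two_lt_sobolevExponent hN
  let q : ℝ≥0 := (sobolevExponent N).toNNReal
  have hq : (q : ℝ) = sobolevExponent N := Real.coe_toNNReal _ (by linarith)
  refine ⟨eLpNormLESNormFDerivOfEqInnerConst (volume : Measure (E N)) 2, ?_⟩
  rintro φ ⟨hφ, hc, hs⟩ u h1 h2
  have hsob := eLpNorm_le_eLpNorm_fderiv_of_eq_inner (volume : Measure (E N)) (F' := ℝ)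
    (p := 2) (p' := q) (hφ.of_le (by exact_mod_cast le_top)) hc (by norm_num)
    (by rw [finrank_euclideanSpace_fin]; omega)
    (by rw [finrank_euclideanSpace_fin, hq, inv_sobolevExponent hN]; rfl)
  rw [eLpNorm_congr_ae h1, Lp.enorm_def, eLpNorm_congr_ae h2]
  have hsupp : Function.support (fun x => ‖fderiv ℝ φ x‖) ⊆ Ω := fun x hx =>
    hs (support_fderiv_subset ℝ fun h => hx (by simp [h]))
  have e1 : eLpNorm (fun x => ‖fderiv ℝ φ x‖) 2 (volume.restrict Ω) =
      eLpNorm (fun x => ‖fderiv ℝ φ x‖) 2 volume :=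
    eLpNorm_restrict_eq_of_support_subset hsupp
  have e2 : eLpNorm (gradient φ) 2 (volume.restrict Ω) =
      eLpNorm (fun x => ‖fderiv ℝ φ x‖) 2 (volume.restrict Ω) :=
    eLpNorm_congr_norm_ae (Eventually.of_forall fun x => by simp [gradient])
  rw [e2, e1, eLpNorm_norm]
  exact (eLpNorm_restrict_le _ _ _ _).trans hsob

/-- Extension by density: Fatou's lemma along an almost everywhere convergent subsequence of test
functions. -/
theorem exists_eLpNorm_le (hN : 3 ≤ N) : ∃ C : ℝ≥0, ∀ u : H10 Ω,
    eLpNorm u.toL2 (ENNReal.ofReal (sobolevExponent N)) (volume.restrict Ω) ≤ C * ‖u.grad‖ₑ := by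
  obtain ⟨C, hC⟩ := exists_eLpNorm_le_of_isTestFunction (Ω := Ω) hN
  refine ⟨C, fun u => ?_⟩
  obtain ⟨φ, w, h1, h2, h3, h4, h5⟩ := u.exists_seq_test
  obtain ⟨k, hk, hae⟩ := (tendstoInMeasure_of_tendsto_Lp h4).exists_seq_tendsto_ae
  refine (Lp.eLpNorm_lim_le_liminf_eLpNorm (fun n => Lp.aestronglyMeasurable (w (k n)).toL2) _
    hae).trans ?_
  have hlim : Tendsto (fun n => (C : ℝ≥0∞) * ‖(w (k n)).grad‖ₑ) atTop (𝓝 (C * ‖u.grad‖ₑ)) :=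
    ENNReal.Tendsto.const_mul (h5.comp hk.tendsto_atTop).enorm (Or.inr ENNReal.coe_ne_top)
  rw [← hlim.liminf_eq]
  exact liminf_le_liminf (Eventually.of_forall fun n => hC _ (h1 _) _ (h2 _) (h3 _))

theorem sobolevConstant_nonneg : 0 ≤ sobolevConstant Ω := by
  refine Real.sInf_nonneg ?_
  rintro r ⟨w, -, rfl⟩
  exact div_nonneg (integral_nonneg fun x => sq_nonneg _)
    (Real.rpow_nonneg (integral_nonneg fun x => by positivity) _)

section Sobolev

variable [Fact (3 ≤ N)]

theorem H10.memLp (u : H10 Ω) :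
    MemLp u.toL2 (ENNReal.ofReal (sobolevExponent N)) (volume.restrict Ω) := by
  obtain ⟨C, hC⟩ := exists_eLpNorm_le (Ω := Ω) (Fact.out : 3 ≤ N)
  exact ⟨Lp.aestronglyMeasurable _, (hC u).trans_lt (ENNReal.mul_lt_top ENNReal.coe_lt_top enorm_lt_top)⟩

theorem H10.integrable_rpow (u : H10 Ω) :
    Integrable (fun x => |u.toL2 x| ^ sobolevExponent N) (volume.restrict Ω) := by
  have h := sobolevExponent_pos (Fact.out : 3 ≤ N)
  have := u.memLp.integrable_norm_rpow (by simpa using h) (by simp)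
  rwa [ENNReal.toReal_ofReal h.le] at this

theorem H10.exists_integral_rpow_le : ∃ C, 0 ≤ C ∧ ∀ u : H10 Ω,
    ∫ x in Ω, |u.toL2 x| ^ sobolevExponent N ≤ C * ‖u‖ ^ sobolevExponent N := by
  obtain ⟨C, hC⟩ := exists_eLpNorm_le (Ω := Ω) (Fact.out : 3 ≤ N)
  have h := sobolevExponent_pos (Fact.out : 3 ≤ N)
  refine ⟨(C : ℝ) ^ sobolevExponent N, by positivity, fun u => ?_⟩
  have h1 := hC u
  rw [u.memLp.eLpNorm_eq_integral_rpow_norm (by simpa using h) (by simp),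
    ENNReal.toReal_ofReal h.le, ← ofReal_norm, ← ENNReal.ofReal_coe_nnreal,
    ← ENNReal.ofReal_mul (by positivity), ENNReal.ofReal_le_ofReal_iff (by positivity)] at h1
  have h2 := Real.rpow_le_rpow (Real.rpow_nonneg
    (integral_nonneg fun x => Real.rpow_nonneg (norm_nonneg _) _) _) h1 h.le
  rw [← Real.rpow_mul (integral_nonneg fun x => Real.rpow_nonneg (norm_nonneg _) _),
    inv_mul_cancel₀ h.ne', Real.rpow_one, Real.mul_rpow (by positivity) (norm_nonneg _)] at h2
  exact h2

/-- The best constant does satisfy the Sobolev inequality. -/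
theorem sobolevConstant_mul_le (u : H10 Ω) : sobolevConstant Ω *
    (∫ x in Ω, |u.toL2 x| ^ sobolevExponent N) ^ (2 / sobolevExponent N) ≤ ‖u‖ ^ 2 := by
  have h := sobolevExponent_pos (Fact.out : 3 ≤ N)
  have h0 : 0 ≤ ∫ x in Ω, |u.toL2 x| ^ sobolevExponent N := integral_nonneg fun x => by positivity
  rcases h0.eq_or_lt' with h1 | h1
  · rw [h1, Real.zero_rpow (by positivity), mul_zero]; positivity
  · rw [← le_div_iff₀ (by positivity)]
    refine csInf_le ⟨0, ?_⟩ ⟨u, ?_, ?_⟩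
    · rintro r ⟨w, -, rfl⟩
      refine div_nonneg (integral_nonneg fun x => sq_nonneg _)
        (Real.rpow_nonneg (integral_nonneg fun x => ?_) _)
      positivity
    · rintro rfl
      refine h1.ne' (integral_eq_zero_of_ae ?_)
      have : ((0 : H10 Ω).toL2 : E N → ℝ) =ᵐ[volume.restrict Ω] 0 := by
        rw [map_zero]; exact Lp.coeFn_zero _ _ _
      filter_upwards [this] with x hx
      simp only [hx, Pi.zero_apply, abs_zero, Real.zero_rpow h.ne']
    · rw [H10.norm_sq_eq_integral]

/-! ### Poincaré's inequality, completeness and weak compactness -/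

/-- Sobolev's inequality followed by Hölder's inequality on the finite measure space `Ω`. -/
theorem H10.exists_norm_toL2_le (hΩ : Bornology.IsBounded Ω) :
    ∃ C, 0 ≤ C ∧ ∀ u : H10 Ω, ‖u.toL2‖ ≤ C * ‖u‖ := by
  obtain ⟨C, hC⟩ := exists_eLpNorm_le (Ω := Ω) (Fact.out : 3 ≤ N)
  have hp := two_lt_sobolevExponent (Fact.out : 3 ≤ N)
  have hfin : volume Ω < ⊤ := hΩ.measure_lt_top
  have hle : (2 : ℝ≥0∞) ≤ ENNReal.ofReal (sobolevExponent N) := by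
    rw [ENNReal.le_ofReal_iff_toReal_le (by simp) (by linarith)]
    simpa using hp.le
  set t := (volume.restrict Ω) Set.univ ^
    (1 / (2 : ℝ≥0∞).toReal - 1 / (ENNReal.ofReal (sobolevExponent N)).toReal) with ht
  have ht' : t ≠ ⊤ := by
    refine ENNReal.rpow_ne_top_of_nonneg ?_ (by simpa using hfin.ne)
    rw [ENNReal.toReal_ofReal (by linarith)]
    simp only [ENNReal.toReal_ofNat, sub_nonneg]
    gcongr
  refine ⟨C * t.toReal, by positivity, fun u => ?_⟩
  have h1 := eLpNorm_le_eLpNorm_mul_rpow_measure_univ hle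
    (Lp.aestronglyMeasurable u.toL2)
  have h2 : ‖u.toL2‖ₑ ≤ C * ‖u.grad‖ₑ * t := by
    rw [Lp.enorm_def]
    exact h1.trans (by gcongr; exact hC u)
  have h3 := ENNReal.toReal_mono (by finiteness) h2
  simp only [ENNReal.toReal_mul, toReal_enorm, ENNReal.coe_toReal] at h3
  rw [H10.norm_eq]
  linarith

/-- The inclusion `H¹₀(Ω) → L²(Ω)` as a continuous linear map. -/
theorem H10.exists_toL2CLM (hΩ : Bornology.IsBounded Ω) :
    ∃ T : H10 Ω →L[ℝ] Lp ℝ 2 (volume.restrict Ω), ∀ u, T u = u.toL2 := by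
  obtain ⟨C, -, hC⟩ := H10.exists_norm_toL2_le hΩ
  exact ⟨⟨H10.toL2, AddMonoidHomClass.continuous_of_bound _ C hC⟩, fun u => rfl⟩

/-- The norm sees only gradients, but Poincaré's inequality makes the `L²` components Cauchy too;
the limit pair stays in the closed subspace. -/
theorem H10.completeSpace (hΩ : Bornology.IsBounded Ω) : CompleteSpace (H10 Ω) := by
  obtain ⟨T, hT⟩ := H10.exists_toL2CLM hΩ
  refine Metric.complete_of_cauchySeq_tendsto fun u hu => ?_
  have hg : CauchySeq fun n => (u n).grad := by
    rw [Metric.cauchySeq_iff] at hu ⊢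
    intro ε hε
    obtain ⟨M, hM⟩ := hu ε hε
    refine ⟨M, fun m hm n hn => ?_⟩
    rw [dist_eq_norm, ← map_sub, ← H10.norm_eq, ← dist_eq_norm]
    exact hM m hm n hn
  have ht : CauchySeq fun n => (u n).toL2 := by
    have := T.uniformContinuous.comp_cauchySeq hu
    simpa only [Function.comp_def, hT] using this
  obtain ⟨a, ha⟩ := cauchySeq_tendsto_of_complete ht
  obtain ⟨b, hb⟩ := cauchySeq_tendsto_of_complete hg
  have hmem : (a, b) ∈ (testPairs Ω).topologicalClosure :=
    (testPairs Ω).isClosed_topologicalClosure.mem_of_tendsto (ha.prodMk_nhds hb)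
      (Eventually.of_forall fun n => (u n).2)
  let v : H10 Ω := ⟨(a, b), hmem⟩
  refine ⟨v, ?_⟩
  rw [tendsto_iff_norm_sub_tendsto_zero] at hb ⊢
  exact hb

end Sobolev

/-- Bounded sequences of a separable Hilbert space have weakly convergent subsequences. -/
theorem exists_seq_tendsto_inner {H : Type*} [NormedAddCommGroup H] [InnerProductSpace ℝ H]
    [CompleteSpace H] [TopologicalSpace.SeparableSpace H] {u : ℕ → H} {R : ℝ}
    (hu : ∀ n, ‖u n‖ ≤ R) : ∃ (v : H) (k : ℕ → ℕ), StrictMono k ∧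
      ∀ w, Tendsto (fun n => inner ℝ (u (k n)) w) atTop (𝓝 (inner ℝ v w)) := by
  obtain ⟨ℓ, -, k, hk, h⟩ := WeakDual.isSeqCompact_closedBall ℝ H (0 : StrongDual ℝ H) R
    (x := fun n => StrongDual.toWeakDual (InnerProductSpace.toDual ℝ H (u n))) (fun n => by
      rw [Set.mem_preimage, mem_closedBall_zero_iff]
      change ‖InnerProductSpace.toDual ℝ H (u n)‖ ≤ R
      rw [LinearIsometryEquiv.norm_map]
      exact hu n)
  refine ⟨(InnerProductSpace.toDual ℝ H).symm (WeakDual.toStrongDual ℓ), k, hk, fun w => ?_⟩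
  have h1 := ((WeakDual.eval_continuous (𝕜 := ℝ) w).tendsto ℓ).comp h
  rw [InnerProductSpace.toDual_symm_apply]
  exact h1

/-- The gradient embeds the space isometrically in a separable `L²` space. -/
theorem H10.separableSpace [Fact (3 ≤ N)] : TopologicalSpace.SeparableSpace (H10 Ω) := by
  have : Fact ((2 : ℝ≥0∞) ≠ ⊤) := ⟨by simp⟩
  have : Isometry (H10.grad (Ω := Ω)) := AddMonoidHomClass.isometry_of_norm _ fun _ => rfl
  have := this.isUniformInducing.isInducing.secondCountableTopology
  infer_instance

end QuasilinearPS

namespace QuasilinearPS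

variable {N : ℕ} {Ω : Set (E N)}

/-! ### Rellich's theorem -/

/-- Jensen's inequality for the square and a probability measure. -/
theorem lintegral_sq_le {α : Type*} [MeasurableSpace α] {ν : Measure α} [IsProbabilityMeasure ν]
    {f : α → ℝ≥0∞} (hf : AEMeasurable f ν) : (∫⁻ x, f x ∂ν) ^ 2 ≤ ∫⁻ x, f x ^ 2 ∂ν := by
  have h := ENNReal.lintegral_mul_le_Lp_mul_Lq ν Real.HolderConjugate.two_two hf
    (aemeasurable_const (b := (1 : ℝ≥0∞)))
  simp only [Pi.mul_apply, mul_one, ENNReal.one_rpow, lintegral_const, measure_univ] at h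
  calc (∫⁻ x, f x ∂ν) ^ 2 ≤ ((∫⁻ x, f x ^ (2 : ℝ) ∂ν) ^ (1 / 2 : ℝ)) ^ 2 := by gcongr
    _ = _ := by
      rw [← ENNReal.rpow_natCast, ← ENNReal.rpow_mul]
      simp

/-- Integrate the derivative along the segment from `x` to `x + h`, apply Jensen's inequality, then
exchange the integrals and use translation invariance. -/
theorem lintegral_sub_translate_sq_le {φ : E N → ℝ} (hφ : ContDiff ℝ 1 φ) (h : E N) :
    ∫⁻ x, ‖φ x - φ (x + h)‖ₑ ^ 2 ≤ ‖h‖ₑ ^ 2 * ∫⁻ x, ‖fderiv ℝ φ x‖ₑ ^ 2 := by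
  have hc : Continuous fun x => fderiv ℝ φ x := hφ.continuous_fderiv one_ne_zero
  have hpt : ∀ x, ‖φ x - φ (x + h)‖ₑ ^ 2 ≤
      ‖h‖ₑ ^ 2 * ∫⁻ t in Set.Icc (0 : ℝ) 1, ‖fderiv ℝ φ (x + t • h)‖ₑ ^ 2 := by
    intro x
    have hd : ∀ t : ℝ, HasDerivAt (fun t : ℝ => φ (x + t • h)) (fderiv ℝ φ (x + t • h) h) t := by
      intro t
      have h1 : HasDerivAt (fun t : ℝ => x + t • h) h t := by
        simpa using ((hasDerivAt_id t).smul_const h).const_add x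
      exact ((hφ.differentiable (by norm_num)) _).hasFDerivAt.comp_hasDerivAt t h1
    have h1 := enorm_sub_le_lintegral_deriv_of_contDiffOn_Icc (f := fun t : ℝ => φ (x + t • h))
      (a := 0) (b := 1) (by fun_prop) zero_le_one
    simp only [one_smul, zero_smul, add_zero] at h1
    have h2 : ‖φ x - φ (x + h)‖ₑ ≤ ∫⁻ t in Set.Icc (0 : ℝ) 1, ‖h‖ₑ * ‖fderiv ℝ φ (x + t • h)‖ₑ := by
      rw [← enorm_neg, neg_sub]
      refine h1.trans (lintegral_mono fun t => ?_)
      rw [(hd t).deriv, mul_comm]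
      exact ContinuousLinearMap.le_opENorm _ _
    have : IsProbabilityMeasure (volume.restrict (Set.Icc (0 : ℝ) 1)) := ⟨by simp⟩
    have hm : Continuous fun t : ℝ => fderiv ℝ φ (x + t • h) := by fun_prop
    calc _ ≤ (∫⁻ t in Set.Icc (0 : ℝ) 1, ‖h‖ₑ * ‖fderiv ℝ φ (x + t • h)‖ₑ) ^ 2 := by gcongr
      _ ≤ _ := lintegral_sq_le (by fun_prop)
      _ = _ := by
        simp_rw [mul_pow]
        rw [lintegral_const_mul' _ _ (by finiteness)]
  have hc2 : Continuous fun z : E N × ℝ => fderiv ℝ φ (z.1 + z.2 • h) := by fun_prop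
  calc _ ≤ ∫⁻ x, ‖h‖ₑ ^ 2 * ∫⁻ t in Set.Icc (0 : ℝ) 1, ‖fderiv ℝ φ (x + t • h)‖ₑ ^ 2 :=
        lintegral_mono hpt
    _ = ‖h‖ₑ ^ 2 * ∫⁻ t in Set.Icc (0 : ℝ) 1, ∫⁻ x, ‖fderiv ℝ φ (x + t • h)‖ₑ ^ 2 := by
        rw [lintegral_const_mul' _ _ (by finiteness), lintegral_lintegral_swap]
        exact (hc2.enorm.measurable.pow_const 2).aemeasurable
    _ = _ := by
        congr 1
        simp_rw [lintegral_add_right_eq_self (fun x => ‖fderiv ℝ φ x‖ₑ ^ 2)]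
        simp

/-- Jensen's inequality reduces the average to the single translations of the previous lemma. -/
theorem lintegral_sub_average_sq_le {φ : E N → ℝ} (hφ : ContDiff ℝ 1 φ) (hs : HasCompactSupport φ)
    {ν : Measure (E N)} [IsProbabilityMeasure ν] {ε : ℝ≥0} (hν : ∀ᵐ h ∂ν, ‖h‖ₑ ≤ ε) :
    ∫⁻ x, ‖φ x - ∫ h, φ (x + h) ∂ν‖ₑ ^ 2 ≤ ε ^ 2 * ∫⁻ x, ‖fderiv ℝ φ x‖ₑ ^ 2 := by
  have hc := hφ.continuous
  obtain ⟨M, hM⟩ := hs.exists_bound_of_continuous hc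
  have hpt : ∀ x, ‖φ x - ∫ h, φ (x + h) ∂ν‖ₑ ^ 2 ≤ ∫⁻ h, ‖φ x - φ (x + h)‖ₑ ^ 2 ∂ν := by
    intro x
    have hi : Integrable (fun h => φ (x + h)) ν :=
      Integrable.of_bound (by fun_prop) M (Eventually.of_forall fun h => hM _)
    have e : φ x - ∫ h, φ (x + h) ∂ν = ∫ h, (φ x - φ (x + h)) ∂ν := by
      rw [integral_sub (integrable_const _) hi]; simp
    rw [e]
    have hm : Continuous fun h => φ x - φ (x + h) := by fun_prop
    calc _ ≤ (∫⁻ h, ‖φ x - φ (x + h)‖ₑ ∂ν) ^ 2 := by gcongr; exact enorm_integral_le_lintegral_enorm _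
      _ ≤ _ := lintegral_sq_le (by fun_prop)
  have hc2 : Continuous fun z : E N × E N => φ z.1 - φ (z.1 + z.2) := by fun_prop
  calc _ ≤ ∫⁻ x, ∫⁻ h, ‖φ x - φ (x + h)‖ₑ ^ 2 ∂ν := lintegral_mono hpt
    _ = ∫⁻ h, (∫⁻ x, ‖φ x - φ (x + h)‖ₑ ^ 2) ∂ν := by
        rw [lintegral_lintegral_swap]
        exact (hc2.enorm.measurable.pow_const 2).aemeasurable
    _ ≤ ∫⁻ _, ε ^ 2 * (∫⁻ x, ‖fderiv ℝ φ x‖ₑ ^ 2) ∂ν := by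
        refine lintegral_mono_ae ?_
        filter_upwards [hν] with h hh
        exact (lintegral_sub_translate_sq_le hφ h).trans (by gcongr)
    _ = _ := by simp

theorem eLpNorm_two_eq {α F : Type*} [MeasurableSpace α] {μ : Measure α} [NormedAddCommGroup F]
    (f : α → F) : eLpNorm f 2 μ = (∫⁻ x, ‖f x‖ₑ ^ 2 ∂μ) ^ (1 / 2 : ℝ) := by
  rw [eLpNorm_eq_lintegral_rpow_enorm_toReal (by norm_num) (by norm_num)]
  simp

variable [Fact (3 ≤ N)]

/-- Averages over balls converge to zero along weakly null sequences of test functions. -/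
theorem tendsto_eLpNorm_average_zero (hΩ : Bornology.IsBounded Ω) {w : ℕ → H10 Ω}
    {φ : ℕ → E N → ℝ} (hφ : ∀ n, IsTestFunction Ω (φ n))
    (hwφ : ∀ n, (w n).toL2 =ᵐ[volume.restrict Ω] φ n) {R : ℝ} (hR : ∀ n, ‖w n‖ ≤ R)
    (hw : ∀ ℓ : H10 Ω →L[ℝ] ℝ, Tendsto (fun n => ℓ (w n)) atTop (𝓝 0)) (ε : ℝ) :
    Tendsto (fun n => eLpNorm (fun x =>
      ∫ h, φ n (x + h) ∂(ProbabilityTheory.cond volume (Metric.ball 0 ε))) 2 (volume.restrict Ω))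
      atTop (𝓝 0) := by
  obtain ⟨T, hT⟩ := H10.exists_toL2CLM (Ω := Ω) hΩ
  set c : ℝ := ((volume (Metric.ball (0 : E N) ε))⁻¹).toReal with hc
  have hfin : ∀ x : E N, (volume.restrict Ω) (Metric.ball x ε) ≠ ⊤ := fun x =>
    ((Measure.restrict_apply_le _ _).trans_lt measure_ball_lt_top).ne
  -- The average at `x` is the `L²` pairing with a normalised indicator of a ball, hence a
  -- continuous linear form. Weak convergence gives pointwise convergence in `x`, and a bound
  -- uniform in `x` allows dominated convergence on the bounded set `Ω`.
  let ℓ : E N → H10 Ω →L[ℝ] ℝ := fun x => c • (innerSL ℝ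
    (indicatorConstLp 2 (μ := volume.restrict Ω) measurableSet_ball (hfin x) (1 : ℝ))).comp T
  have hℓ : ∀ n x, ∫ h, φ n (x + h) ∂(ProbabilityTheory.cond volume (Metric.ball 0 ε)) =
      ℓ x (w n) := by
    intro n x
    have hsub : Function.support (φ n) ⊆ Ω := (subset_tsupport _).trans (hφ n).2.2
    have e1 : ∫ h in Metric.ball 0 ε, φ n (x + h) = ∫ y in Metric.ball x ε, φ n y := by
      have := (measurePreserving_add_left volume x).setIntegral_preimage_emb
        (measurableEmbedding_addLeft x) (φ n) (Metric.ball x ε)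
      simpa using this
    have e2 : ∫ y in Metric.ball x ε, φ n y = ∫ y in Metric.ball x ε, φ n y ∂(volume.restrict Ω) := by
      rw [Measure.restrict_restrict measurableSet_ball]
      refine setIntegral_eq_of_subset_of_forall_sdiff_eq_zero measurableSet_ball
        Set.inter_subset_left fun y hy => ?_
      by_contra h
      exact hy.2 ⟨hy.1, hsub h⟩
    rw [ProbabilityTheory.cond, integral_smul_measure, e1, e2]
    change _ = c * inner ℝ _ (T (w n))
    rw [hT, L2.inner_indicatorConstLp_one, smul_eq_mul]
    congr 1
    exact integral_congr_ae (ae_restrict_of_ae ((hwφ n).symm))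
  obtain ⟨K, hK⟩ : ∃ K, ∀ x n, ‖ℓ x (w n)‖ ≤ K := by
    refine ⟨|c| * ((1 * (volume (Metric.ball (0 : E N) ε)).toReal ^ (1 / (2 : ℝ≥0∞).toReal)) *
      (‖T‖ * R)), fun x n => ?_⟩
    change ‖c * inner ℝ _ (T (w n))‖ ≤ _
    rw [norm_mul, Real.norm_eq_abs]
    gcongr
    refine (norm_inner_le_norm _ _).trans ?_
    gcongr
    · refine norm_indicatorConstLp_le.trans ?_
      rw [norm_one]
      gcongr
      rw [measureReal_def]
      refine ENNReal.toReal_mono measure_ball_lt_top.ne ?_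
      refine (Measure.restrict_apply_le _ _).trans_eq ?_
      rw [Measure.addHaar_ball_center]
    · exact (T.le_opNorm _).trans (by gcongr; exact hR n)
  have hmeas : ∀ n, AEStronglyMeasurable (fun x => ℓ x (w n)) (volume.restrict Ω) := by
    intro n
    simp_rw [← hℓ]
    have hc2 : Continuous fun z : E N × E N => φ n (z.1 + z.2) := by
      have := (hφ n).1.continuous
      fun_prop
    exact hc2.stronglyMeasurable.integral_prod_right'.aestronglyMeasurable
  have hfin' : IsFiniteMeasure (volume.restrict Ω) := ⟨by simpa using hΩ.measure_lt_top⟩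
  simp_rw [hℓ, eLpNorm_two_eq]
  have hlim : Tendsto (fun n => ∫⁻ x in Ω, ‖ℓ x (w n)‖ₑ ^ 2) atTop (𝓝 (∫⁻ _ in Ω, 0)) := by
    refine tendsto_lintegral_of_dominated_convergence' (fun _ => ENNReal.ofReal K ^ 2)
      (fun n => (hmeas n).enorm.pow_const 2) (fun n => Eventually.of_forall fun x => ?_) ?_
      (Eventually.of_forall fun x => ?_)
    · beta_reduce
      rw [← ofReal_norm]
      gcongr
      exact hK x n
    · rw [lintegral_const]
      finiteness
    · have := (hw (ℓ x)).enorm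
      simpa using ENNReal.Tendsto.pow (n := 2) this
  simpa using hlim.ennrpow_const (1 / 2)

theorem H10.tendsto_toL2_zero_of_isTestFunction (hΩ : Bornology.IsBounded Ω) {w : ℕ → H10 Ω}
    {φ : ℕ → E N → ℝ} (hφ : ∀ n, IsTestFunction Ω (φ n))
    (hwφ : ∀ n, (w n).toL2 =ᵐ[volume.restrict Ω] φ n)
    (hgφ : ∀ n, (w n).grad =ᵐ[volume.restrict Ω] gradient (φ n)) {R : ℝ} (hR : ∀ n, ‖w n‖ ≤ R)
    (hw : ∀ ℓ : H10 Ω →L[ℝ] ℝ, Tendsto (fun n => ℓ (w n)) atTop (𝓝 0)) :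
    Tendsto (fun n => (w n).toL2) atTop (𝓝 0) := by
  rw [tendsto_zero_iff_norm_tendsto_zero]
  have hR0 : 0 ≤ R := (norm_nonneg _).trans (hR 0)
  rw [Metric.tendsto_atTop]
  intro η hη
  -- With averages over balls of this radius, the distance from `w n` to its average is at most `ε R
  -- < η/2`, uniformly in `n`; the average itself is small for large `n`.
  let ε : ℝ≥0 := ⟨η / 2 / (R + 1), by positivity⟩
  have hε : 0 < (ε : ℝ) := show 0 < η / 2 / (R + 1) by positivity
  have hε1 : (ε : ℝ) * R < η / 2 := by
    change η / 2 / (R + 1) * R < η / 2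
    rw [div_mul_eq_mul_div, div_lt_iff₀ (by positivity)]
    nlinarith
  have hA := tendsto_eLpNorm_average_zero hΩ hφ hwφ hR hw ε
  obtain ⟨M, hM⟩ := (hA.eventually (gt_mem_nhds
    (show 0 < ENNReal.ofReal (η / 2) by simpa using hη))).exists_forall_of_atTop
  refine ⟨M, fun n hn => ?_⟩
  have hball : volume (Metric.ball (0 : E N) ε) ≠ 0 := (Metric.measure_ball_pos _ _ hε).ne'
  set ν := ProbabilityTheory.cond volume (Metric.ball (0 : E N) ε) with hν
  have hprob : IsProbabilityMeasure ν :=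
    ProbabilityTheory.cond_isProbabilityMeasure_of_finite hball measure_ball_lt_top.ne
  have hsmall : ∀ᵐ h ∂ν, ‖h‖ₑ ≤ ε := by
    filter_upwards [ProbabilityTheory.ae_cond_mem measurableSet_ball] with h hh
    rw [mem_ball_zero_iff] at hh
    exact_mod_cast hh.le
  have hφ1 : ContDiff ℝ 1 (φ n) := (hφ n).1.of_le (by exact_mod_cast le_top)
  have hc2 : Continuous fun z : E N × E N => φ n (z.1 + z.2) := by
    have := hφ1.continuous
    fun_prop
  have hAm : StronglyMeasurable fun x => ∫ h, φ n (x + h) ∂ν :=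
    hc2.stronglyMeasurable.integral_prod_right'
  have hgrad : eLpNorm (fderiv ℝ (φ n)) 2 volume = ‖w n‖ₑ := by
    have hsupp : Function.support (fun x => ‖fderiv ℝ (φ n) x‖) ⊆ Ω := fun x hx =>
      (hφ n).2.2 (support_fderiv_subset ℝ fun h => hx (by simp [h]))
    rw [← eLpNorm_norm, ← eLpNorm_restrict_eq_of_support_subset hsupp,
      ← ofReal_norm, H10.norm_eq, ofReal_norm, Lp.enorm_def, eLpNorm_congr_ae (hgφ n)]
    exact eLpNorm_congr_norm_ae (Eventually.of_forall fun x => by simp [gradient])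
  have h1 : eLpNorm (fun x => φ n x - ∫ h, φ n (x + h) ∂ν) 2 (volume.restrict Ω) ≤
      ENNReal.ofReal (η / 2) := by
    calc _ ≤ eLpNorm (fun x => φ n x - ∫ h, φ n (x + h) ∂ν) 2 volume := eLpNorm_restrict_le _ _ _ _
      _ ≤ (ε ^ 2 * ∫⁻ x, ‖fderiv ℝ (φ n) x‖ₑ ^ 2) ^ (1 / 2 : ℝ) := by
        rw [eLpNorm_two_eq]
        gcongr
        exact lintegral_sub_average_sq_le hφ1 (hφ n).2.1 hsmall
      _ = ε * ‖w n‖ₑ := by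
        rw [ENNReal.mul_rpow_of_nonneg _ _ (by norm_num), ← eLpNorm_two_eq, hgrad,
          ← ENNReal.rpow_natCast, ← ENNReal.rpow_mul]
        simp
      _ ≤ _ := by
        rw [← ofReal_norm, ← ENNReal.ofReal_coe_nnreal, ← ENNReal.ofReal_mul hε.le]
        refine ENNReal.ofReal_le_ofReal (le_trans ?_ hε1.le)
        gcongr
        exact hR n
  have h2 : ‖(w n).toL2‖ₑ < ENNReal.ofReal η := by
    rw [Lp.enorm_def, eLpNorm_congr_ae (hwφ n)]
    have e : φ n = (fun x => φ n x - ∫ h, φ n (x + h) ∂ν) + fun x => ∫ h, φ n (x + h) ∂ν := by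
      funext x; simp
    rw [e]
    refine (eLpNorm_add_le (hφ1.continuous.aestronglyMeasurable.sub hAm.aestronglyMeasurable)
      hAm.aestronglyMeasurable one_le_two).trans_lt ?_
    rw [show η = η / 2 + η / 2 by ring, ENNReal.ofReal_add (by positivity) (by positivity)]
    exact ENNReal.add_lt_add_of_le_of_lt (h1.trans_lt ENNReal.ofReal_lt_top).ne h1 (hM n hn)
  rw [← ofReal_norm, ENNReal.ofReal_lt_ofReal_iff hη] at h2
  simpa using h2

/-- **Rellich's theorem**: weak convergence in `H¹₀(Ω)` implies strong convergence in `L²(Ω)`. -/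
theorem H10.tendsto_toL2_zero (hΩ : Bornology.IsBounded Ω) {w : ℕ → H10 Ω} {R : ℝ}
    (hR : ∀ n, ‖w n‖ ≤ R)
    (hw : ∀ ℓ : H10 Ω →L[ℝ] ℝ, Tendsto (fun n => ℓ (w n)) atTop (𝓝 0)) :
    Tendsto (fun n => (w n).toL2) atTop (𝓝 0) := by
  obtain ⟨T, hT⟩ := H10.exists_toL2CLM (Ω := Ω) hΩ
  -- Each `w n` is replaced by a test function at distance below `1/(n+1)`. The errors tend to zero
  -- strongly, so weak convergence persists, and the norms stay below `R + 1`.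
  have happ : ∀ n, ∃ (φ : E N → ℝ) (z : H10 Ω), IsTestFunction Ω φ ∧
      z.toL2 =ᵐ[volume.restrict Ω] φ ∧ z.grad =ᵐ[volume.restrict Ω] gradient φ ∧
      ‖z - w n‖ < 1 / ((n : ℝ) + 1) := by
    intro n
    obtain ⟨φ, z, h1, h2, h3, -, h5⟩ := (w n).exists_seq_test
    rw [tendsto_iff_norm_sub_tendsto_zero] at h5
    obtain ⟨m, hm⟩ := (h5.eventually (gt_mem_nhds
      (show 0 < 1 / ((n : ℝ) + 1) by positivity))).exists
    exact ⟨φ m, z m, h1 m, h2 m, h3 m, by rwa [H10.norm_eq, map_sub]⟩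
  choose φ z h1 h2 h3 h4 using happ
  have hzw : Tendsto (fun n => z n - w n) atTop (𝓝 0) := by
    rw [tendsto_zero_iff_norm_tendsto_zero]
    exact squeeze_zero (fun n => norm_nonneg _) (fun n => (h4 n).le)
      tendsto_one_div_add_atTop_nhds_zero_nat
  have hz := H10.tendsto_toL2_zero_of_isTestFunction hΩ h1 h2 h3 (R := R + 1) (fun n => by
      have h5 : 1 / ((n : ℝ) + 1) ≤ 1 := by
        rw [div_le_one (by positivity)]; linarith [(Nat.cast_nonneg n : (0 : ℝ) ≤ n)]
      have h6 := norm_add_le (z n - w n) (w n)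
      rw [sub_add_cancel] at h6
      linarith [h4 n, hR n]) (fun ℓ => by
      have h5 := ((ℓ.continuous.tendsto 0).comp hzw).add (hw ℓ)
      simpa [Function.comp_def] using h5)
  have h5 := hz.sub ((T.continuous.tendsto 0).comp hzw)
  simpa [Function.comp_def, hT] using h5

end QuasilinearPS

namespace QuasilinearPS

variable {N : ℕ} {Ω : Set (E N)}

/-! ### Differentiability of the critical functional -/

theorem add_rpow_le_two_rpow_mul {p x y : ℝ} (hp : 0 ≤ p) (hx : 0 ≤ x) (hy : 0 ≤ y) :
    (x + y) ^ p ≤ 2 ^ p * (x ^ p + y ^ p) := by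
  have h1 : x + y ≤ 2 * max x y := by linarith [le_max_left x y, le_max_right x y]
  calc (x + y) ^ p ≤ (2 * max x y) ^ p := by gcongr
    _ = 2 ^ p * max x y ^ p := Real.mul_rpow (by norm_num) (hx.trans (le_max_left _ _))
    _ ≤ _ := by
      gcongr
      have h2 := Real.rpow_nonneg hx p
      have h3 := Real.rpow_nonneg hy p
      rcases max_cases x y with h | h <;> rw [h.1] <;> linarith

theorem H10.coeFn_add (u w : H10 Ω) :
    (u + w).toL2 =ᵐ[volume.restrict Ω] fun x => u.toL2 x + w.toL2 x := by
  rw [map_add]; exact Lp.coeFn_add _ _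

theorem H10.coeFn_smul (c : ℝ) (u : H10 Ω) :
    (c • u).toL2 =ᵐ[volume.restrict Ω] fun x => c * u.toL2 x := by
  rw [map_smul]; exact Lp.coeFn_smul _ _

theorem H10.aestronglyMeasurable (u : H10 Ω) :
    AEStronglyMeasurable u.toL2 (volume.restrict Ω) := Lp.aestronglyMeasurable _

variable [Fact (3 ≤ N)]

theorem H10.integrable_add_rpow (u w : H10 Ω) :
    Integrable (fun x => (|u.toL2 x| + |w.toL2 x|) ^ sobolevExponent N) (volume.restrict Ω) := by
  have hp := sobolevExponent_pos (Fact.out : 3 ≤ N)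
  refine ((u.integrable_rpow.add w.integrable_rpow).const_mul (2 ^ sobolevExponent N)).mono' ?_
    (Eventually.of_forall fun x => ?_)
  · refine (Continuous.rpow_const (f := fun z : ℝ × ℝ => |z.1| + |z.2|) (by fun_prop)
      fun _ => Or.inr hp.le).comp_aestronglyMeasurable
      (u.aestronglyMeasurable.prodMk w.aestronglyMeasurable)
  · rw [Real.norm_of_nonneg (by positivity)]
    exact add_rpow_le_two_rpow_mul hp.le (abs_nonneg _) (abs_nonneg _)

theorem H10.exists_integral_add_rpow_le (u : H10 Ω) : ∃ K, 0 ≤ K ∧ ∀ w : H10 Ω, ‖w‖ ≤ 1 →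
    ∫ x in Ω, (|u.toL2 x| + |w.toL2 x|) ^ sobolevExponent N ≤ K := by
  have hp := sobolevExponent_pos (Fact.out : 3 ≤ N)
  obtain ⟨C, hC, h⟩ := H10.exists_integral_rpow_le (Ω := Ω)
  have h0 : 0 ≤ ∫ x in Ω, |u.toL2 x| ^ sobolevExponent N := integral_nonneg fun x => by positivity
  refine ⟨2 ^ sobolevExponent N * ((∫ x in Ω, |u.toL2 x| ^ sobolevExponent N) + C),
    by positivity, fun w hw => ?_⟩
  calc _ ≤ ∫ x in Ω, 2 ^ sobolevExponent N *
        (|u.toL2 x| ^ sobolevExponent N + |w.toL2 x| ^ sobolevExponent N) :=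
        integral_mono (u.integrable_add_rpow w)
          ((u.integrable_rpow.add w.integrable_rpow).const_mul _)
          fun x => add_rpow_le_two_rpow_mul hp.le (abs_nonneg _) (abs_nonneg _)
    _ ≤ _ := by
      rw [integral_const_mul, integral_add u.integrable_rpow w.integrable_rpow]
      gcongr
      refine (h w).trans (mul_le_of_le_one_right hC ?_)
      exact Real.rpow_le_one (norm_nonneg _) hw hp.le

theorem abs_slope_mul_le {p : ℝ} (hp : 1 < p) (a b : ℝ) :
    |slope p a * b| ≤ slopeCoeff p * (|a| + |b|) ^ p := by
  have hc := slopeCoeff_pos p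
  calc |slope p a * b| ≤ slopeCoeff p * |a| ^ (p - 1) * |b| := by
        rw [abs_mul]; gcongr; exact abs_slope_le hp.le a
    _ ≤ slopeCoeff p * (|a| + |b|) ^ (p - 1) * (|a| + |b|) := by
        gcongr
        · linarith [abs_nonneg b]
        · linarith [abs_nonneg a]
    _ = slopeCoeff p * ((|a| + |b|) ^ (p - 1) * (|a| + |b|)) := by ring
    _ = _ := by rw [← Real.rpow_add_one' (by positivity) (by linarith), sub_add_cancel]

theorem H10.integrable_slope_mul (u w : H10 Ω) :
    Integrable (fun x => slope (sobolevExponent N) (u.toL2 x) * w.toL2 x) (volume.restrict Ω) := by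
  have hp := two_lt_sobolevExponent (Fact.out : 3 ≤ N)
  refine ((u.integrable_add_rpow w).const_mul (slopeCoeff (sobolevExponent N))).mono'
    (((continuous_slope hp).comp_aestronglyMeasurable u.aestronglyMeasurable).mul
      w.aestronglyMeasurable) (Eventually.of_forall fun x => ?_)
  exact abs_slope_mul_le (by linarith) _ _

theorem H10.integrable_density (u : H10 Ω) :
    Integrable (fun x => density (sobolevExponent N) (u.toL2 x)) (volume.restrict Ω) := by
  have hp := two_lt_sobolevExponent (Fact.out : 3 ≤ N)
  refine (u.integrable_rpow.const_mul (2 * slopeCoeff (sobolevExponent N))).mono'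
    ((continuous_density (by linarith)).comp_aestronglyMeasurable u.aestronglyMeasurable)
    (Eventually.of_forall fun x => ?_)
  rw [Real.norm_of_nonneg (density_nonneg _ _)]
  exact density_le (by linarith) _

/-- Every element is its norm times an element of the closed unit ball. -/
theorem H10.exists_eq_smul (w : H10 Ω) : ∃ z : H10 Ω, ‖z‖ ≤ 1 ∧ w = ‖w‖ • z := by
  rcases eq_or_ne w 0 with rfl | hw
  · exact ⟨0, by simp, by simp⟩
  · have h : ‖w‖ ≠ 0 := norm_ne_zero_iff.2 hw
    refine ⟨‖w‖⁻¹ • w, ?_, ?_⟩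
    · rw [norm_smul, norm_inv, norm_norm, inv_mul_cancel₀ h]
    · rw [smul_smul, mul_inv_cancel₀ h, one_smul]

/-- By homogeneity it suffices to bound the integral on the unit ball, where `(|u| + |z|)^p` has
uniformly bounded integral. -/
theorem H10.exists_abs_integral_slope_mul_le (u : H10 Ω) : ∃ C, ∀ w : H10 Ω,
    ‖∫ x in Ω, slope (sobolevExponent N) (u.toL2 x) * w.toL2 x‖ ≤ C * ‖w‖ := by
  have hp := two_lt_sobolevExponent (Fact.out : 3 ≤ N)
  obtain ⟨K, hK, h⟩ := u.exists_integral_add_rpow_le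
  refine ⟨slopeCoeff (sobolevExponent N) * K, fun w => ?_⟩
  obtain ⟨z, hz, hwz⟩ := w.exists_eq_smul
  have hae : (fun x => slope (sobolevExponent N) (u.toL2 x) * w.toL2 x) =ᵐ[volume.restrict Ω]
      fun x => ‖w‖ * (slope (sobolevExponent N) (u.toL2 x) * z.toL2 x) := by
    filter_upwards [H10.coeFn_smul ‖w‖ z] with x hx
    rw [← hwz] at hx
    rw [hx]; ring
  rw [integral_congr_ae hae, integral_const_mul, norm_mul, norm_norm, mul_comm]
  gcongr
  calc _ ≤ ∫ x in Ω, slopeCoeff (sobolevExponent N) *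
        (|u.toL2 x| + |z.toL2 x|) ^ sobolevExponent N :=
        norm_integral_le_of_norm_le ((u.integrable_add_rpow z).const_mul _)
          (Eventually.of_forall fun x => abs_slope_mul_le (by linarith) _ _)
    _ ≤ _ := by
        rw [integral_const_mul]
        exact mul_le_mul_of_nonneg_left (h z hz) (slopeCoeff_pos _).le

/-- The continuous linear form `w ↦ ∫ |f(u)|^{2·2*-2} f(u) f'(u) w`. -/
theorem H10.exists_slopeForm (u : H10 Ω) : ∃ L : H10 Ω →L[ℝ] ℝ, ∀ w : H10 Ω,
    L w = ∫ x in Ω, slope (sobolevExponent N) (u.toL2 x) * w.toL2 x := by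
  obtain ⟨C, hC⟩ := u.exists_abs_integral_slope_mul_le
  let L : H10 Ω →ₗ[ℝ] ℝ :=
    { toFun := fun w => ∫ x in Ω, slope (sobolevExponent N) (u.toL2 x) * w.toL2 x
      map_add' := fun w z => by
        rw [← integral_add (u.integrable_slope_mul w) (u.integrable_slope_mul z)]
        refine integral_congr_ae ?_
        filter_upwards [H10.coeFn_add w z] with x hx
        rw [hx, mul_add]
      map_smul' := fun c w => by
        rw [RingHom.id_apply, smul_eq_mul, ← integral_const_mul]
        refine integral_congr_ae ?_
        filter_upwards [H10.coeFn_smul c w] with x hx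
        rw [hx]; ring }
  exact ⟨L.mkContinuous C hC, fun w => rfl⟩

/-- Integrated Taylor estimate. Writing `w = ‖w‖ z` extracts `‖w‖²` from the pointwise remainder and
leaves an integral of `(|u| + |z|)^p`, bounded uniformly over the unit ball. -/
theorem exists_abs_integral_density_taylor_le (u : H10 Ω) : ∃ K, 0 ≤ K ∧ ∀ w : H10 Ω, ‖w‖ ≤ 1 →
    |(∫ x in Ω, density (sobolevExponent N) ((u + w).toL2 x)) -
      (∫ x in Ω, density (sobolevExponent N) (u.toL2 x)) - 2 * sobolevExponent N *
        ∫ x in Ω, slope (sobolevExponent N) (u.toL2 x) * w.toL2 x| ≤ K * ‖w‖ ^ 2 := by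
  have hp := two_lt_sobolevExponent (Fact.out : 3 ≤ N)
  set p := sobolevExponent N with hpdef
  obtain ⟨K, hK, h⟩ := u.exists_integral_add_rpow_le
  obtain ⟨C, hC, hT⟩ := exists_density_taylor_le hp
  refine ⟨C * K, by positivity, fun w hw1 => ?_⟩
  obtain ⟨z, hz, hwz⟩ := w.exists_eq_smul
  have e : (∫ x in Ω, density p ((u + w).toL2 x)) - (∫ x in Ω, density p (u.toL2 x)) -
      2 * p * ∫ x in Ω, slope p (u.toL2 x) * w.toL2 x =
      ∫ x in Ω, (density p ((u + w).toL2 x) - density p (u.toL2 x) -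
        2 * p * (slope p (u.toL2 x) * w.toL2 x)) := by
    have hi : Integrable (fun x => density p ((u + w).toL2 x) - density p (u.toL2 x))
        (volume.restrict Ω) := (u + w).integrable_density.sub u.integrable_density
    rw [integral_sub hi ((u.integrable_slope_mul w).const_mul _),
      integral_sub (u + w).integrable_density u.integrable_density, integral_const_mul]
  rw [e, ← Real.norm_eq_abs]
  calc _ ≤ ∫ x in Ω, C * ‖w‖ ^ 2 * (|u.toL2 x| + |z.toL2 x|) ^ p := by
        refine norm_integral_le_of_norm_le ((u.integrable_add_rpow z).const_mul _) ?_
        filter_upwards [H10.coeFn_smul ‖w‖ z, H10.coeFn_add u w] with x h1 h2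
        rw [← hwz] at h1
        rw [h2, Real.norm_eq_abs, ← mul_assoc]
        refine (hT _ _).trans ?_
        rw [mul_assoc]
        gcongr C * ?_
        have hwz' : |w.toL2 x| ≤ |z.toL2 x| := by
          rw [h1, abs_mul, abs_norm]
          exact mul_le_of_le_one_left (abs_nonneg _) hw1
        have h3 : z.toL2 x ^ 2 ≤ (|u.toL2 x| + |z.toL2 x|) ^ 2 := by
          rw [← sq_abs]
          gcongr
          linarith [abs_nonneg (u.toL2 x)]
        calc _ ≤ (|u.toL2 x| + |z.toL2 x|) ^ (p - 2) * (‖w‖ ^ 2 * (|u.toL2 x| + |z.toL2 x|) ^ 2) := by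
              rw [h1, mul_pow]
              rw [h1] at hwz'
              gcongr
          _ = ‖w‖ ^ 2 * ((|u.toL2 x| + |z.toL2 x|) ^ (p - 2) * (|u.toL2 x| + |z.toL2 x|) ^ (2 : ℝ)) := by
              rw [Real.rpow_two]; ring
          _ = _ := by
              rw [← Real.rpow_add_of_nonneg (by positivity) (by linarith) (by norm_num),
                sub_add_cancel]
    _ ≤ _ := by
        rw [integral_const_mul]
        have := mul_le_mul_of_nonneg_left (h z hz) (show 0 ≤ C * ‖w‖ ^ 2 by positivity)
        linarith

theorem criticalFunctional_eq (v : H10 Ω) : criticalFunctional Ω v = 1 / 2 * ‖v‖ ^ 2 -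
    1 / (2 * sobolevExponent N) * ∫ x in Ω, density (sobolevExponent N) (v.toL2 x) := by
  rw [H10.norm_sq_eq_integral]; rfl

/-- The quadratic remainder proves Fréchet differentiability at every `v`, so `fderiv` is here the
true derivative and never its default value `0`. -/
theorem fderiv_criticalFunctional_apply (v w : H10 Ω) :
    fderiv ℝ (criticalFunctional Ω) v w = inner ℝ v w -
      ∫ x in Ω, slope (sobolevExponent N) (v.toL2 x) * w.toL2 x := by
  have hp := sobolevExponent_pos (Fact.out : 3 ≤ N)
  obtain ⟨L, hL⟩ := v.exists_slopeForm
  obtain ⟨K, hK, hT⟩ := exists_abs_integral_density_taylor_le v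
  have h1 : HasFDerivAt (fun v : H10 Ω => ∫ x in Ω, density (sobolevExponent N) (v.toL2 x))
      ((2 * sobolevExponent N) • L) v := by
    rw [hasFDerivAt_iff_isLittleO_nhds_zero]
    refine Asymptotics.IsBigO.trans_isLittleO (g := fun w : H10 Ω => ‖w‖ ^ 2) ?_
      (Asymptotics.isLittleO_norm_pow_id one_lt_two)
    refine Asymptotics.IsBigO.of_bound K ?_
    filter_upwards [Metric.closedBall_mem_nhds (0 : H10 Ω) one_pos] with z hz
    rw [mem_closedBall_zero_iff] at hz
    rw [norm_pow, norm_norm, smul_apply, hL, smul_eq_mul, Real.norm_eq_abs]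
    exact hT z hz
  have h2 := ((hasStrictFDerivAt_norm_sq v).hasFDerivAt.const_mul (1 / 2 : ℝ)).sub
    (h1.const_mul (1 / (2 * sobolevExponent N)))
  have h3 : HasFDerivAt (criticalFunctional Ω) _ v :=
    h2.congr_of_eventuallyEq (Eventually.of_forall fun v => criticalFunctional_eq v)
  rw [h3.fderiv]
  simp only [sub_apply, smul_apply, hL, smul_eq_mul,
    innerSL_apply_apply, nsmul_eq_mul]
  field_simp
  push_cast
  ring

end QuasilinearPS

namespace QuasilinearPS

variable {N : ℕ} {Ω : Set (E N)}

/-! ### The Palais-Smale condition -/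

theorem satisfiesPalaisSmale_of_norm {H : Type*} [NormedAddCommGroup H] [NormedSpace ℝ H]
    {I : H → ℝ} {d : ℝ} (h : ∀ u : ℕ → H, Tendsto (fun n => I (u n)) atTop (𝓝 d) →
      Tendsto (fun n => ‖fderiv ℝ I (u n)‖) atTop (𝓝 0) →
      ∃ (v : H) (k : ℕ → ℕ), StrictMono k ∧ Tendsto (fun n => u (k n)) atTop (𝓝 v)) :
    SatisfiesPalaisSmale I d :=
  fun u h1 h2 => h u h1 (by simpa using h2.norm)

theorem half_sub_inv_sobolevExponent (hN : 3 ≤ N) :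
    1 / 2 - 1 / sobolevExponent N = 1 / (N : ℝ) := by
  have := inv_sobolevExponent hN
  simp only [one_div]
  linarith

variable [Fact (3 ≤ N)]

/-- Weak compactness, then Rellich's theorem, then a further subsequence to pass from `L²` to almost
everywhere convergence. -/
theorem H10.exists_subseq (hΩ : Bornology.IsBounded Ω) {u : ℕ → H10 Ω} {R : ℝ}
    (hu : ∀ n, ‖u n‖ ≤ R) : ∃ (v : H10 Ω) (k : ℕ → ℕ), StrictMono k ∧
      (∀ z, Tendsto (fun n => inner ℝ (u (k n) - v) z) atTop (𝓝 0)) ∧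
      ∀ᵐ x ∂volume.restrict Ω, Tendsto (fun n => (u (k n) - v).toL2 x) atTop (𝓝 0) := by
  have := H10.completeSpace (Ω := Ω) hΩ
  have := H10.separableSpace (Ω := Ω)
  obtain ⟨v, k, hk, hw⟩ := exists_seq_tendsto_inner hu
  have hw' : ∀ z, Tendsto (fun n => inner ℝ (u (k n) - v) z) atTop (𝓝 0) := fun z => by
    simp_rw [inner_sub_left]
    simpa using (hw z).sub_const (inner ℝ v z)
  have hL : Tendsto (fun n => (u (k n) - v).toL2) atTop (𝓝 0) := by
    refine H10.tendsto_toL2_zero hΩ (R := R + ‖v‖)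
      (fun n => (norm_sub_le _ _).trans (by gcongr; exact hu _)) fun ℓ => ?_
    refine (hw' ((InnerProductSpace.toDual ℝ (H10 Ω)).symm ℓ)).congr fun n => ?_
    rw [real_inner_comm, InnerProductSpace.toDual_symm_apply]
  obtain ⟨m, hm, hae⟩ := (tendstoInMeasure_of_tendsto_Lp hL).exists_seq_tendsto_ae
  refine ⟨v, k ∘ m, hk.comp hm, fun z => (hw' z).comp hm.tendsto_atTop, ?_⟩
  filter_upwards [hae, Lp.coeFn_zero ℝ 2 (volume.restrict Ω)] with x hx h0
  rwa [h0] at hx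

/-- Superposition operators with a remainder of order `ε |a|^p + C (1 + |b|^p)` are continuous
along bounded sequences which tend to zero almost everywhere. -/
theorem tendsto_integral_split (hΩ : Bornology.IsBounded Ω) {F : ℝ → ℝ → ℝ}
    (hF : Continuous (Function.uncurry F)) (hF0 : ∀ b, F 0 b = 0)
    (hFb : ∀ ε > 0, ∃ C, 0 ≤ C ∧ ∀ a b, |F a b| ≤
      ε * |a| ^ sobolevExponent N + C * (1 + |b| ^ sobolevExponent N))
    {a : ℕ → H10 Ω} {R : ℝ} (hR : ∀ n, ‖a n‖ ≤ R)
    (ha : ∀ᵐ x ∂volume.restrict Ω, Tendsto (fun n => (a n).toL2 x) atTop (𝓝 0)) (v : H10 Ω) :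
    Tendsto (fun n => ∫ x in Ω, F ((a n).toL2 x) (v.toL2 x)) atTop (𝓝 0) := by
  have hp := sobolevExponent_pos (Fact.out : 3 ≤ N)
  have hfin : IsFiniteMeasure (volume.restrict Ω) := ⟨by simpa using hΩ.measure_lt_top⟩
  obtain ⟨C, hC, hS⟩ := H10.exists_integral_rpow_le (Ω := Ω)
  refine tendsto_integral_zero_of_abs_le (W := fun n x => |(a n).toL2 x| ^ sobolevExponent N)
    (K := C * R ^ sobolevExponent N)
    (fun n => hF.comp_aestronglyMeasurable
      ((a n).aestronglyMeasurable.prodMk v.aestronglyMeasurable))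
    (fun n x => by positivity) (fun n => (a n).integrable_rpow) (fun n => ?_) ?_ fun ε hε => ?_
  · refine (hS _).trans ?_
    gcongr
    exact hR n
  · filter_upwards [ha] with x hx
    have := (hF.tendsto (0, v.toL2 x)).comp (hx.prodMk_nhds tendsto_const_nhds)
    rwa [Function.uncurry_apply_pair, hF0] at this
  · obtain ⟨C', hC', h⟩ := hFb ε hε
    exact ⟨fun x => C' * (1 + |v.toL2 x| ^ sobolevExponent N),
      ((integrable_const 1).add v.integrable_rpow).const_mul C',
      fun n => Eventually.of_forall fun x => h _ _⟩

/-! ### Boundedness of Palais-Smale sequences. -/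

theorem H10.integral_density_le (v : H10 Ω) :
    ∫ x in Ω, density (sobolevExponent N) (v.toL2 x) ≤
      2 * ∫ x in Ω, slope (sobolevExponent N) (v.toL2 x) * v.toL2 x := by
  have hp := two_lt_sobolevExponent (Fact.out : 3 ≤ N)
  rw [← integral_const_mul]
  refine integral_mono v.integrable_density ((v.integrable_slope_mul v).const_mul 2) fun x => ?_
  have := density_le_mul_slope (by linarith : 1 < sobolevExponent N) (v.toL2 x)
  beta_reduce
  linarith

/-- The Ambrosetti-Rabinowitz type estimate `I(v) - I'(v)v / 2* ≥ ‖v‖² / N`. -/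
theorem norm_sq_div_le_criticalFunctional_sub (v : H10 Ω) :
    1 / (N : ℝ) * ‖v‖ ^ 2 ≤ criticalFunctional Ω v -
      1 / sobolevExponent N * fderiv ℝ (criticalFunctional Ω) v v := by
  have hp := sobolevExponent_pos (Fact.out : 3 ≤ N)
  have h := v.integral_density_le
  rw [criticalFunctional_eq, fderiv_criticalFunctional_apply, real_inner_self_eq_norm_sq,
    ← half_sub_inv_sobolevExponent Fact.out]
  have h2 := mul_le_mul_of_nonneg_left h (show 0 ≤ 1 / (2 * sobolevExponent N) by positivity)
  have e : 1 / (2 * sobolevExponent N) * (2 * ∫ x in Ω, slope (sobolevExponent N) (v.toL2 x) *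
    v.toL2 x) = 1 / sobolevExponent N * ∫ x in Ω, slope (sobolevExponent N) (v.toL2 x) *
    v.toL2 x := by field_simp
  rw [e] at h2
  linarith

/-- The estimate `‖u n‖² ≤ N (|A| + B ‖u n‖)` is quadratic on the left and affine on the right. -/
theorem exists_norm_le_of_palaisSmale {u : ℕ → H10 Ω} {d : ℝ}
    (h1 : Tendsto (fun n => criticalFunctional Ω (u n)) atTop (𝓝 d))
    (h2 : Tendsto (fun n => ‖fderiv ℝ (criticalFunctional Ω) (u n)‖) atTop (𝓝 0)) :
    ∃ R, ∀ n, ‖u n‖ ≤ R := by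
  have hp := two_lt_sobolevExponent (Fact.out : 3 ≤ N)
  have hN : (0 : ℝ) < N := by
    have : 3 ≤ N := Fact.out
    exact_mod_cast (by omega : 0 < N)
  obtain ⟨A, hA⟩ := h1.bddAbove_range
  obtain ⟨B, hB⟩ := h2.bddAbove_range
  have hB0 : 0 ≤ B := (norm_nonneg (fderiv ℝ (criticalFunctional Ω) (u 0))).trans (hB ⟨0, rfl⟩)
  refine ⟨1 + N * (|A| + B), fun n => ?_⟩
  have h3 := norm_sq_div_le_criticalFunctional_sub (u n)
  have h4 : criticalFunctional Ω (u n) ≤ |A| := (hA ⟨n, rfl⟩).trans (le_abs_self A)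
  have h5 : ‖fderiv ℝ (criticalFunctional Ω) (u n)‖ ≤ B := hB ⟨n, rfl⟩
  have h6 : -(1 / sobolevExponent N * fderiv ℝ (criticalFunctional Ω) (u n) (u n)) ≤ B * ‖u n‖ := by
    refine (neg_le_abs _).trans ?_
    rw [abs_mul, abs_of_pos (by positivity)]
    have h7 := (fderiv ℝ (criticalFunctional Ω) (u n)).le_opNorm (u n)
    rw [Real.norm_eq_abs] at h7
    have h8 : 1 / sobolevExponent N ≤ 1 := by rw [div_le_one (by linarith)]; linarith
    calc _ ≤ 1 * (‖fderiv ℝ (criticalFunctional Ω) (u n)‖ * ‖u n‖) := by gcongr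
      _ ≤ _ := by rw [one_mul]; gcongr
  have h9 : ‖u n‖ ^ 2 ≤ N * (|A| + B * ‖u n‖) := by
    rw [one_div, inv_mul_le_iff₀ hN] at h3
    refine h3.trans ?_
    gcongr
    linarith
  by_contra! h10
  have hA0 := abs_nonneg A
  have h11 : 0 ≤ N * (|A| + B) := by positivity
  have h12 : 1 < ‖u n‖ := by linarith
  have h13 : N * |A| * 1 ≤ N * |A| * ‖u n‖ := by gcongr
  nlinarith

/-! ### Sobolev's inequality and the energy threshold. -/

theorem slopeCoeff_rpow_le {p : ℝ} (hp : 0 < p) : slopeCoeff p ^ (2 / p) ≤ 2 := by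
  rw [slopeCoeff, ← Real.rpow_mul (by norm_num)]
  have e : (p / 2 - 1) * (2 / p) = 1 - 2 / p := by field_simp
  rw [e]
  calc (2 : ℝ) ^ (1 - 2 / p) ≤ 2 ^ (1 : ℝ) := by
        apply Real.rpow_le_rpow_of_exponent_le (by norm_num)
        have : 0 < 2 / p := by positivity
        linarith
    _ = 2 := by simp

/-- The hypothesis gives `S b^(2/p) ≤ 2b`, hence `S/2 ≤ b^(1-2/p) = b^(2/n)`. -/
theorem half_rpow_le_of_sobolev {p n S b : ℝ} (hp : 0 < p) (hn : 0 < n) (hpn : 1 / 2 - 1 / p = 1 / n)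
    (hS : 0 ≤ S) (hb : 0 < b) (h : S * (b / slopeCoeff p) ^ (2 / p) ≤ b) : (S / 2) ^ (n / 2) ≤ b := by
  have hc := slopeCoeff_pos p
  rw [Real.div_rpow hb.le hc.le, ← mul_div_assoc, div_le_iff₀ (by positivity)] at h
  have h1 : S * b ^ (2 / p) ≤ b * 2 := h.trans (by gcongr; exact slopeCoeff_rpow_le hp)
  have h2 : S / 2 ≤ b ^ (2 / n) := by
    have e : 2 / n = 1 - 2 / p := by
      have : 2 / n = 2 * (1 / n) := by ring
      rw [this, ← hpn]; ring
    rw [e, Real.rpow_sub hb, Real.rpow_one, le_div_iff₀ (by positivity)]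
    linarith
  calc (S / 2) ^ (n / 2) ≤ (b ^ (2 / n)) ^ (n / 2) := by gcongr
    _ = b := by
      rw [← Real.rpow_mul hb.le]
      have : 2 / n * (n / 2) = 1 := by field_simp
      rw [this, Real.rpow_one]

/-- The three limits which describe the loss of compactness along a Palais-Smale sequence. -/
theorem tendsto_of_palaisSmale (hΩ : Bornology.IsBounded Ω) {a : ℕ → H10 Ω} {v : H10 Ω} {R d : ℝ}
    (hR : ∀ n, ‖a n‖ ≤ R) (hw : ∀ z, Tendsto (fun n => inner ℝ (a n) z) atTop (𝓝 0))
    (ha : ∀ᵐ x ∂volume.restrict Ω, Tendsto (fun n => (a n).toL2 x) atTop (𝓝 0))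
    (h1 : Tendsto (fun n => criticalFunctional Ω (a n + v)) atTop (𝓝 d))
    (h2 : Tendsto (fun n => ‖fderiv ℝ (criticalFunctional Ω) (a n + v)‖) atTop (𝓝 0)) :
    0 ≤ criticalFunctional Ω v ∧
    Tendsto (fun n => ‖a n‖ ^ 2) atTop (𝓝 (N * (d - criticalFunctional Ω v))) ∧
    Tendsto (fun n => slopeCoeff (sobolevExponent N) *
      ∫ x in Ω, |(a n).toL2 x| ^ sobolevExponent N) atTop
      (𝓝 (N * (d - criticalFunctional Ω v))) := by
  have hp := two_lt_sobolevExponent (Fact.out : 3 ≤ N)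
  have hp0 := sobolevExponent_pos (Fact.out : 3 ≤ N)
  have hhalf := half_sub_inv_sobolevExponent (Fact.out : 3 ≤ N)
  have hN : (0 : ℝ) < N := by
    have : 3 ≤ N := Fact.out
    exact_mod_cast (by omega : 0 < N)
  have hslope := continuous_slope hp
  have hdens := continuous_density (by linarith : 1 < sobolevExponent N)
  have hpowc : Continuous fun t : ℝ => |t| ^ sobolevExponent N :=
    Continuous.rpow_const (by fun_prop) fun _ => Or.inr hp0.le
  have hv := norm_sq_div_le_criticalFunctional_sub v
  have hvI := criticalFunctional_eq v
  have hder := fderiv_criticalFunctional_apply v v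
  generalize criticalFunctional Ω v = Iv at *
  have hcrit := fun n => criticalFunctional_eq (a n + v)
  have hfd := fun n => fderiv_criticalFunctional_apply (a n + v)
  have F1 := tendsto_integral_split (N := N) (Ω := Ω) hΩ
    (F := fun s t => density (sobolevExponent N) (s + t) - density (sobolevExponent N) t -
      2 * slopeCoeff (sobolevExponent N) * |s| ^ sobolevExponent N) (by
        have h3 := hpowc.comp (continuous_fst (X := ℝ) (Y := ℝ))
        have h4 := hdens.comp (continuous_add (M := ℝ))
        have h5 := hdens.comp (continuous_snd (X := ℝ) (Y := ℝ))
        exact (h4.sub h5).sub (h3.const_mul _)) (fun b => by simp [hp0.ne'])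
      (fun ε hε => exists_abs_density_split_le (by linarith) hε) hR ha v
  have F2 := tendsto_integral_split (N := N) (Ω := Ω) hΩ
    (F := fun s t => slope (sobolevExponent N) (s + t) * s -
      slopeCoeff (sobolevExponent N) * |s| ^ sobolevExponent N) (by
        have h3 := hpowc.comp (continuous_fst (X := ℝ) (Y := ℝ))
        have h4 := hslope.comp (continuous_add (M := ℝ))
        exact (h4.mul continuous_fst).sub (h3.const_mul _)) (fun b => by simp [hp0.ne'])
      (fun ε hε => exists_abs_slope_mul_split_le (by linarith) hε) hR ha v
  have F3 := tendsto_integral_split (N := N) (Ω := Ω) hΩ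
    (F := fun s t => (slope (sobolevExponent N) (s + t) - slope (sobolevExponent N) t) * t) (by
        have h4 := hslope.comp (continuous_add (M := ℝ))
        have h5 := hslope.comp (continuous_snd (X := ℝ) (Y := ℝ))
        exact (h4.sub h5).mul continuous_snd) (fun b => by simp)
      (fun ε hε => exists_abs_slope_sub_mul_le (by linarith) hε) hR ha v
  have e1 : ∀ n, ∫ x in Ω, (density (sobolevExponent N) ((a n).toL2 x + v.toL2 x) -
      density (sobolevExponent N) (v.toL2 x) - 2 * slopeCoeff (sobolevExponent N) *
        |(a n).toL2 x| ^ sobolevExponent N) =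
      (∫ x in Ω, density (sobolevExponent N) ((a n + v).toL2 x)) -
      (∫ x in Ω, density (sobolevExponent N) (v.toL2 x)) -
      2 * (slopeCoeff (sobolevExponent N) * ∫ x in Ω, |(a n).toL2 x| ^ sobolevExponent N) := by
    intro n
    have hi : Integrable (fun x => density (sobolevExponent N) ((a n + v).toL2 x) -
        density (sobolevExponent N) (v.toL2 x)) (volume.restrict Ω) :=
      (a n + v).integrable_density.sub v.integrable_density
    rw [← integral_sub (a n + v).integrable_density v.integrable_density, ← mul_assoc,
      ← integral_const_mul, ← integral_sub hi ((a n).integrable_rpow.const_mul _)]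
    refine integral_congr_ae ?_
    filter_upwards [H10.coeFn_add (a n) v] with x hx
    rw [hx]
  have e2 : ∀ n, ∫ x in Ω, (slope (sobolevExponent N) ((a n).toL2 x + v.toL2 x) * (a n).toL2 x -
      slopeCoeff (sobolevExponent N) * |(a n).toL2 x| ^ sobolevExponent N) =
      (∫ x in Ω, slope (sobolevExponent N) ((a n + v).toL2 x) * (a n).toL2 x) -
      slopeCoeff (sobolevExponent N) * ∫ x in Ω, |(a n).toL2 x| ^ sobolevExponent N := by
    intro n
    rw [← integral_const_mul, ← integral_sub ((a n + v).integrable_slope_mul (a n))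
      ((a n).integrable_rpow.const_mul _)]
    refine integral_congr_ae ?_
    filter_upwards [H10.coeFn_add (a n) v] with x hx
    rw [hx]
  have e3 : ∀ n, ∫ x in Ω, (slope (sobolevExponent N) ((a n).toL2 x + v.toL2 x) -
      slope (sobolevExponent N) (v.toL2 x)) * v.toL2 x =
      (∫ x in Ω, slope (sobolevExponent N) ((a n + v).toL2 x) * v.toL2 x) -
      ∫ x in Ω, slope (sobolevExponent N) (v.toL2 x) * v.toL2 x := by
    intro n
    rw [← integral_sub ((a n + v).integrable_slope_mul v) (v.integrable_slope_mul v)]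
    refine integral_congr_ae ?_
    filter_upwards [H10.coeFn_add (a n) v] with x hx
    rw [hx, sub_mul]
  simp only [e1] at F1
  simp only [e2] at F2
  simp only [e3] at F3
  have D1 : Tendsto (fun n => fderiv ℝ (criticalFunctional Ω) (a n + v) v) atTop (𝓝 0) := by
    have h3 : Tendsto (fun n => ‖fderiv ℝ (criticalFunctional Ω) (a n + v)‖ * ‖v‖) atTop (𝓝 0) := by
      simpa using h2.mul_const ‖v‖
    exact squeeze_zero_norm (fun n => ContinuousLinearMap.le_opNorm _ _) h3
  have D2 : Tendsto (fun n => fderiv ℝ (criticalFunctional Ω) (a n + v) (a n)) atTop (𝓝 0) := by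
    have h3 : Tendsto (fun n => ‖fderiv ℝ (criticalFunctional Ω) (a n + v)‖ * R) atTop (𝓝 0) := by
      simpa using h2.mul_const R
    exact squeeze_zero_norm (fun n => (ContinuousLinearMap.le_opNorm _ _).trans
      (by gcongr; exact hR n)) h3
  simp only [hfd, inner_add_left, real_inner_self_eq_norm_sq] at D1 D2
  have hwv := hw v
  -- Only `I'(v)v = 0` is needed, not the full criticality of `v`: test the derivative against `v`
  -- and use the third splitting.
  have hz : ‖v‖ ^ 2 - ∫ x in Ω, slope (sobolevExponent N) (v.toL2 x) * v.toL2 x = 0 := by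
    have h3 := (D1.add F3).sub hwv
    refine tendsto_nhds_unique (tendsto_const_nhds.congr fun n => ?_) (by simpa using h3)
    ring
  rw [real_inner_self_eq_norm_sq, hz] at hder
  have hI0 : 0 ≤ Iv := by
    rw [hder, mul_zero, sub_zero] at hv
    exact le_trans (by positivity) hv
  -- Testing the derivative against the bounded sequence `a n` compares the two quantities.
  have G2 : Tendsto (fun n => ‖a n‖ ^ 2 - slopeCoeff (sobolevExponent N) *
      ∫ x in Ω, |(a n).toL2 x| ^ sobolevExponent N) atTop (𝓝 0) := by
    have h3 := (D2.add F2).sub hwv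
    rw [add_zero, sub_zero] at h3
    refine h3.congr fun n => ?_
    rw [real_inner_comm (a n) v]
    ring
  have hnorm : ∀ n, ‖a n + v‖ ^ 2 = ‖a n‖ ^ 2 + 2 * inner ℝ (a n) v + ‖v‖ ^ 2 := fun n =>
    norm_add_sq_real _ _
  have G1 : Tendsto (fun n => 1 / 2 * ‖a n‖ ^ 2 - 1 / sobolevExponent N *
      (slopeCoeff (sobolevExponent N) * ∫ x in Ω, |(a n).toL2 x| ^ sobolevExponent N)) atTop
      (𝓝 (d - Iv)) := by
    have h3 := ((h1.sub_const Iv).add (F1.const_mul (1 / (2 * sobolevExponent N)))).sub hwv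
    rw [mul_zero, add_zero, sub_zero] at h3
    refine h3.congr fun n => ?_
    rw [hcrit, hnorm, hvI]
    field_simp
    ring
  -- Subtracting `1/p` times `G2` from `G1` leaves `(1/2 - 1/p) ‖a n‖² = ‖a n‖² / N`.
  have G3 : Tendsto (fun n => ‖a n‖ ^ 2) atTop (𝓝 (N * (d - Iv))) := by
    have h3 := (G1.sub (G2.const_mul (1 / sobolevExponent N))).const_mul (N : ℝ)
    rw [mul_zero, sub_zero] at h3
    refine h3.congr fun n => ?_
    have e4 : 1 / 2 * ‖a n‖ ^ 2 = (1 / N + 1 / sobolevExponent N) * ‖a n‖ ^ 2 := by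
      rw [← hhalf]; ring
    rw [e4]
    field_simp
    ring
  refine ⟨hI0, G3, ?_⟩
  have h3 := G3.sub G2
  rw [sub_zero] at h3
  exact h3.congr fun n => by ring

theorem exists_tendsto_subseq_of_palaisSmale (hΩ : Bornology.IsBounded Ω) {d : ℝ}
    (hd : d < 1 / N * (sobolevConstant Ω / 2) ^ ((N : ℝ) / 2)) {u : ℕ → H10 Ω}
    (h1 : Tendsto (fun n => criticalFunctional Ω (u n)) atTop (𝓝 d))
    (h2 : Tendsto (fun n => ‖fderiv ℝ (criticalFunctional Ω) (u n)‖) atTop (𝓝 0)) :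
    ∃ (v : H10 Ω) (k : ℕ → ℕ), StrictMono k ∧ Tendsto (fun n => u (k n)) atTop (𝓝 v) := by
  have hp := sobolevExponent_pos (Fact.out : 3 ≤ N)
  have hN : (0 : ℝ) < N := by
    have : 3 ≤ N := Fact.out
    exact_mod_cast (by omega : 0 < N)
  obtain ⟨R, hR⟩ := exists_norm_le_of_palaisSmale h1 h2
  obtain ⟨v, k, hk, hw, hae⟩ := H10.exists_subseq hΩ hR
  have h1' : Tendsto (fun n => criticalFunctional Ω (u (k n) - v + v)) atTop (𝓝 d) := by
    simp_rw [sub_add_cancel]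
    exact h1.comp hk.tendsto_atTop
  have h2' : Tendsto (fun n => ‖fderiv ℝ (criticalFunctional Ω) (u (k n) - v + v)‖) atTop
      (𝓝 0) := by
    simp_rw [sub_add_cancel]
    exact h2.comp hk.tendsto_atTop
  obtain ⟨hI, hlim, hlim'⟩ := tendsto_of_palaisSmale hΩ (a := fun n => u (k n) - v)
    (R := R + ‖v‖) (fun n => (norm_sub_le _ _).trans (by gcongr; exact hR _)) hw hae h1' h2'
  refine ⟨v, k, hk, ?_⟩
  set b := (N : ℝ) * (d - criticalFunctional Ω v) with hb
  have hb0 : 0 ≤ b := ge_of_tendsto' hlim fun n => by positivity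
  -- Either no energy is lost and convergence is strong, or the positive limit `b` obeys Sobolev's
  -- inequality and pushes `d = I(v) + b/N` up to the threshold, since `I(v) ≥ 0`.
  rcases hb0.eq_or_lt' with hb1 | hb1
  · rw [hb1] at hlim
    rw [tendsto_iff_norm_sub_tendsto_zero]
    have h3 := hlim.sqrt
    simpa [Real.sqrt_sq (norm_nonneg _)] using h3
  · exfalso
    have hc := slopeCoeff_pos (sobolevExponent N)
    have h3 : sobolevConstant Ω * (b / slopeCoeff (sobolevExponent N)) ^ (2 / sobolevExponent N) ≤
        b := by
      have h4 := ((hlim'.div_const (slopeCoeff (sobolevExponent N))).rpow_const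
        (p := 2 / sobolevExponent N) (Or.inr (by positivity))).const_mul (sobolevConstant Ω)
      refine le_of_tendsto_of_tendsto' h4 hlim fun n => ?_
      rw [mul_div_cancel_left₀ _ hc.ne']
      exact sobolevConstant_mul_le _
    have h5 := half_rpow_le_of_sobolev hp hN (half_sub_inv_sobolevExponent Fact.out)
      sobolevConstant_nonneg hb1 h3
    have h6 : 1 / (N : ℝ) * (sobolevConstant Ω / 2) ^ ((N : ℝ) / 2) ≤ 1 / N * b := by gcongr
    have h7 : 1 / (N : ℝ) * b = d - criticalFunctional Ω v := by rw [hb]; field_simp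
    linarith

end QuasilinearPS

end

theorem proposition3p11 {N : ℕ} [Fact (3 ≤ N)] (Ω : Set (QuasilinearPS.E N)) (hΩ_open : IsOpen Ω)
    (hΩ_bounded : Bornology.IsBounded Ω) (hΩ_nonempty : Ω.Nonempty) (d : ℝ)
    (hd : d < 1 / N * (QuasilinearPS.sobolevConstant Ω / 2) ^ ((N : ℝ) / 2)) :
    QuasilinearPS.SatisfiesPalaisSmale (QuasilinearPS.criticalFunctional Ω) d :=
  QuasilinearPS.satisfiesPalaisSmale_of_norm fun _ h1 h2 =>
    QuasilinearPS.exists_tendsto_subseq_of_palaisSmale hΩ_bounded hd h1 h2
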